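/- A $d$-dimensional knapsack instance $\mathcal I=(I,p,c,B)$ consists of a finite set $I$ of items, a profit function $p:I\to\mathbb N$, a cost function $c:I\to\mathbb N^d$ and a budget $B\in\mathbb N^d$ (all numbers given in binary). A solution is a set $S\subseteq I$ with $\sum_{i\in S}c_j(i)\le B_j$ for all $j\in\{1,\dots,d\}$; its profit is $p(S)=\sum_{i\in S}p(i)$, and $\mathrm{OPT}(\mathcal I)$ is the maximum profit of a solution. For $\rho\in(0,1)$, a $\rho$-approximation algorithm for $d$-dimensional knapsack is a deterministic algorithm that on every $d$-dimensional instance $\mathcal I$ returns a solution $S$ with $p(S)\ge\rho\cdot\mathrm{OPT}(\mathcal I)$. For $D\in\mathbb N$, a 3-SAT$(D)$ instance $\phi$ is a set of $m$ clauses over $n$ Boolean variables, each clause being a disjunction of three literals, such that each variable appears in at most $D$ clauses; $\mathrm{SAT}(\phi)$ is the maximum number of clauses satisfied by a single assignment. The Gap Exponential Time Hypothesis (Gap-ETH) states that there exist $D\in\mathbb N$ and $\delta,\varepsilon\in(0,1)$ such that no deterministic algorithm, given a 3-SAT$(D)$ instance $\phi$ with $n$ variables and $m$ clauses, distinguishes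 between $\mathrm{SAT}(\phi)=m$ and $\mathrm{SAT}(\phi)<(1-\varepsilon)m$ in time $O(2^{\delta n})$. (Algorithms and their running times refer to a fixed deterministic machine model that is polynomially equivalent to multi-tape Turing machines, namely programs with finitely many variables holding immutable binary trees, in which every allocation of a cell, dereference, copy of a reference and test takes one step; neither Gap-ETH nor the theorem depends on the choice among such models.) **Theorem.** Assume Gap-ETH. For every constant $\rho\in(0,1)$ there exist constants $\delta>0$ and $d_0\in\mathbb N$ such that for every constant $d\ge d_0$ there is no $\rho$-approximation algorithm for $d$-dimensional knapsack that runs in time $O(n^{\delta\sqrt d})$, where $n$ is the encoding size of the instance. -/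

import Mathlib

namespace VK

/-! ## The machine model

Deterministic programs over binary trees (the data of pure LISP): finitely many variables, each
holding a pointer to an immutable tree; an elementary step tests one variable, or makes one
assignment built from `nil`, one cell allocation, or one pointer dereference. Each such step has
cost one. This model and multi-tape Turing machines (or log-cost RAMs) simulate each other with
polynomial overhead, and an algorithm is a program of the model. -/

/-- Binary trees. -/
inductive Data : Type
  | nil : Data
  | cons : Data → Data → Data

namespace Data

/-- Left component (`nil` for `nil`). -/
def fst : Data → Data
  | nil => nil
  | cons a _ => a

/-- Right component (`nil` for `nil`). -/
def snd : Data → Data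
  | nil => nil
  | cons _ b => b

/-- Encoding size: the number of nodes of the tree, counting leaves. -/
def size : Data → ℕ
  | nil => 1
  | cons a b => 1 + size a + size b

/-- The two truth values as trees. -/
def ofBool : Bool → Data
  | false => nil
  | true => cons nil nil

/-- A list of trees as a tree. -/
def ofList : List Data → Data
  | [] => nil
  | a :: l => cons a (ofList l)

/-- A natural number in binary, least significant bit first. -/
def ofNat (n : ℕ) : Data := ofList (n.bits.map ofBool)

end Data

/-- Programs; variables are numbered by naturals. -/
inductive Prog : Type
  | setNil (x : ℕ) : Prog
  | copy (x y : ℕ) : Prog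
  | setCons (x y z : ℕ) : Prog
  | setFst (x y : ℕ) : Prog
  | setSnd (x y : ℕ) : Prog
  | seq (p q : Prog) : Prog
  | branch (x : ℕ) (p q : Prog) : Prog
  | loop (x : ℕ) (p : Prog) : Prog

/-- A memory state assigns a tree to each variable. -/
abbrev Store : Type := ℕ → Data

/-- `Exec p s t s'`: program `p`, started in memory state `s`, halts after exactly `t` elementary
steps in memory state `s'`. `branch x p q` runs `p` if `x` is not `nil` and `q` otherwise;
`loop x p` repeats `p` as long as `x` is not `nil`; each test is one step. -/
inductive Exec : Prog → Store → ℕ → Store → Prop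
  | setNil (x : ℕ) (s : Store) :
      Exec (.setNil x) s 1 (Function.update s x Data.nil)
  | copy (x y : ℕ) (s : Store) :
      Exec (.copy x y) s 1 (Function.update s x (s y))
  | setCons (x y z : ℕ) (s : Store) :
      Exec (.setCons x y z) s 1 (Function.update s x (Data.cons (s y) (s z)))
  | setFst (x y : ℕ) (s : Store) :
      Exec (.setFst x y) s 1 (Function.update s x (s y).fst)
  | setSnd (x y : ℕ) (s : Store) :
      Exec (.setSnd x y) s 1 (Function.update s x (s y).snd)
  | seq {p q : Prog} {s s' s'' : Store} {t t' : ℕ} :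
      Exec p s t s' → Exec q s' t' s'' → Exec (.seq p q) s (t + t') s''
  | branchTrue {x : ℕ} {p q : Prog} {s s' : Store} {t : ℕ} :
      s x ≠ Data.nil → Exec p s t s' → Exec (.branch x p q) s (1 + t) s'
  | branchFalse {x : ℕ} {p q : Prog} {s s' : Store} {t : ℕ} :
      s x = Data.nil → Exec q s t s' → Exec (.branch x p q) s (1 + t) s'
  | loopDone {x : ℕ} {p : Prog} {s : Store} :
      s x = Data.nil → Exec (.loop x p) s 1 s
  | loopStep {x : ℕ} {p : Prog} {s s' s'' : Store} {t t' : ℕ} :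
      s x ≠ Data.nil → Exec p s t s' → Exec (.loop x p) s' t' s'' →
      Exec (.loop x p) s (1 + t + t') s''

/-- Execution is deterministic, in the result and in the number of steps. -/
theorem Exec.unique {p : Prog} {s s₁ : Store} {t₁ : ℕ} (h₁ : Exec p s t₁ s₁) :
    ∀ {t₂ : ℕ} {s₂ : Store}, Exec p s t₂ s₂ → t₁ = t₂ ∧ s₁ = s₂ := by
  induction h₁ with
  | setNil | copy | setCons | setFst | setSnd => intro _ _ h; cases h; exact ⟨rfl, rfl⟩
  | seq _ _ ih ih' =>
    intro _ _ h
    cases h with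
    | seq a b =>
      obtain ⟨rfl, rfl⟩ := ih a
      obtain ⟨rfl, rfl⟩ := ih' b
      exact ⟨rfl, rfl⟩
  | branchTrue hx _ ih =>
    intro _ _ h
    cases h with
    | branchTrue _ a => obtain ⟨rfl, rfl⟩ := ih a; exact ⟨rfl, rfl⟩
    | branchFalse hx' _ => exact absurd hx' hx
  | branchFalse hx _ ih =>
    intro _ _ h
    cases h with
    | branchTrue hx' _ => exact absurd hx hx'
    | branchFalse _ a => obtain ⟨rfl, rfl⟩ := ih a; exact ⟨rfl, rfl⟩
  | loopDone hx =>
    intro _ _ h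
    cases h with
    | loopDone => exact ⟨rfl, rfl⟩
    | loopStep hx' _ _ => exact absurd hx hx'
  | loopStep hx _ _ ih ih' =>
    intro _ _ h
    cases h with
    | loopDone hx' => exact absurd hx' hx
    | loopStep _ a b =>
      obtain ⟨rfl, rfl⟩ := ih a
      obtain ⟨rfl, rfl⟩ := ih' b
      exact ⟨rfl, rfl⟩

/-- On input `x` (in variable `0`, all other variables being `nil`), the program halts after
exactly `t` steps with output `y` (in variable `0`). -/
def Prog.Outputs (p : Prog) (x : Data) (t : ℕ) (y : Data) : Prop :=
  ∃ s : Store, Exec p (Function.update (fun _ => Data.nil) 0 x) t s ∧ s 0 = y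

/-- The program, on instances from `α` encoded by `enc`, always halts, within time `O(T)`. -/
def Prog.RunsInTime {α : Type} (p : Prog) (enc : α → Data) (T : α → ℝ) : Prop :=
  ∃ C : ℝ, ∀ a : α, ∃ (t : ℕ) (y : Data), p.Outputs (enc a) t y ∧ (t : ℝ) ≤ C * T a

/-! ## 3-SAT with bounded occurrence, and Gap-ETH -/

/-- A disjunction of three literals; `(v, true)` is the variable `v`, `(v, false)` its negation. -/
abbrev Clause (n : ℕ) : Type := Fin 3 → Fin n × Bool

/-- The set of literals of a clause. -/
def Clause.literals {n : ℕ} (c : Clause n) : Finset (Fin n × Bool) := Finset.univ.image c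

/-- Some literal of the clause is true. -/
abbrev Clause.Satisfied {n : ℕ} (c : Clause n) (s : Fin n → Bool) : Prop :=
  ∃ j : Fin 3, s (c j).1 = (c j).2

/-- The variable `v` appears in the clause. -/
abbrev Clause.Mentions {n : ℕ} (c : Clause n) (v : Fin n) : Prop :=
  ∃ j : Fin 3, (c j).1 = v

/-- A 3-SAT(`D`) instance: a set of clauses, listed in some order, no clause being listed twice,
such that each variable appears in at most `D` clauses. -/
structure ThreeSat (D : ℕ) where
  numVars : ℕ
  clauses : List (Clause numVars)
  distinct : (clauses.map Clause.literals).Nodup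
  degree_le : ∀ v : Fin numVars, clauses.countP (fun c => decide (c.Mentions v)) ≤ D

namespace ThreeSat

variable {D : ℕ}

/-- The number `m` of clauses. -/
def numClauses (φ : ThreeSat D) : ℕ := φ.clauses.length

/-- The number of clauses satisfied by an assignment. -/
def numSatisfied (φ : ThreeSat D) (s : Fin φ.numVars → Bool) : ℕ :=
  φ.clauses.countP (fun c => decide (c.Satisfied s))

/-- The maximum number of clauses satisfied by a single assignment. -/
def sat (φ : ThreeSat D) : ℕ := Finset.univ.sup φ.numSatisfied

/-- The literal as a pair of its sign and the binary index of its variable. -/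
def encodeLiteral {n : ℕ} (l : Fin n × Bool) : Data :=
  Data.cons (Data.ofBool l.2) (Data.ofNat l.1)

/-- The instance as the pair of the number of variables and the list of clauses. -/
def encode (φ : ThreeSat D) : Data :=
  Data.cons (Data.ofNat φ.numVars)
    (Data.ofList (φ.clauses.map fun c => Data.ofList (List.ofFn fun j => encodeLiteral (c j))))

end ThreeSat

/-- The program answers `true` on the 3-SAT(`D`) instances with `SAT(φ) = m` and `false` on those
with `SAT(φ) < (1 - ε) m`. -/
def DistinguishesGap (D : ℕ) (ε : ℝ) (p : Prog) : Prop :=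
  ∀ φ : ThreeSat D, ∃ (t : ℕ) (b : Bool), p.Outputs φ.encode t (Data.ofBool b) ∧
    (φ.sat = φ.numClauses → b = true) ∧
    ((φ.sat : ℝ) < (1 - ε) * (φ.numClauses : ℝ) → b = false)

/-- The Gap Exponential Time Hypothesis. -/
def GapETH : Prop :=
  ∃ (D : ℕ) (δ ε : ℝ), 0 < δ ∧ δ < 1 ∧ 0 < ε ∧ ε < 1 ∧
    ¬ ∃ p : Prog, DistinguishesGap D ε p ∧
      p.RunsInTime (ThreeSat.encode (D := D)) (fun φ => (2 : ℝ) ^ (δ * (φ.numVars : ℝ)))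

/-! ## `d`-dimensional knapsack -/

/-- An instance of `d`-dimensional knapsack, with item set `Fin numItems`. -/
structure Instance (d : ℕ) where
  numItems : ℕ
  profit : Fin numItems → ℕ
  cost : Fin numItems → Fin d → ℕ
  budget : Fin d → ℕ

namespace Instance

variable {d : ℕ}

/-- The set of items respects the budget in every coordinate. -/
abbrev IsSolution (I : Instance d) (S : Finset (Fin I.numItems)) : Prop :=
  ∀ j : Fin d, ∑ i ∈ S, I.cost i j ≤ I.budget j

/-- Total profit. -/
def totalProfit (I : Instance d) (S : Finset (Fin I.numItems)) : ℕ := ∑ i ∈ S, I.profit i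

/-- The maximum profit of a solution. -/
def opt (I : Instance d) : ℕ :=
  (Finset.univ.filter fun S : Finset (Fin I.numItems) => I.IsSolution S).sup I.totalProfit

/-- A solution of profit at least `ρ` times the optimum. -/
def IsApproximate (I : Instance d) (ρ : ℝ) (S : Finset (Fin I.numItems)) : Prop :=
  I.IsSolution S ∧ ρ * (I.opt : ℝ) ≤ (I.totalProfit S : ℝ)

/-- The pair of the list of items, each with its profit and its list of costs, and the list of
budgets; all numbers are in binary. -/
def encode (I : Instance d) : Data :=
  Data.cons
    (Data.ofList (List.ofFn fun i =>
      Data.cons (Data.ofNat (I.profit i))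
        (Data.ofList (List.ofFn fun j => Data.ofNat (I.cost i j)))))
    (Data.ofList (List.ofFn fun j => Data.ofNat (I.budget j)))

/-- The encoding size of the instance. -/
def size (I : Instance d) : ℕ := I.encode.size

/-- A set of items as the list of its membership bits. -/
def encodeSet (I : Instance d) (S : Finset (Fin I.numItems)) : Data :=
  Data.ofList (List.ofFn fun i => Data.ofBool (decide (i ∈ S)))

end Instance

/-- The program returns a `ρ`-approximate solution of every `d`-dimensional knapsack instance. -/
def IsApproxAlgorithm (d : ℕ) (ρ : ℝ) (p : Prog) : Prop :=
  ∀ I : Instance d, ∃ (t : ℕ) (S : Finset (Fin I.numItems)),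
    p.Outputs I.encode t (I.encodeSet S) ∧ I.IsApproximate ρ S

end VK

/-!
Gap-ETH is reduced to the approximation of knapsack. Let `φ` be a 3-SAT(`D`) formula with `n`
variables and `m` clauses, let `k = ⌊√d⌋`, and fix `r` with `(1 - ρ) ^ r ≤ ε`. The clauses are
distributed over `k` groups: the positions of the clause list run cyclically through all `r`-tuples
of groups, and a clause belongs to the groups that occur in its tuple (the first `k ^ r` clauses
belong to every group). So a group has about `r m / k` clauses (`card_selected_le`), while any `ρ k`
groups together miss at most the fraction `(1 - ρ) ^ r ≤ ε` of all clauses (`card_missed_le`).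

An item of the knapsack instance is a group together with an assignment to the variables of its
clauses that satisfies all of them; it has profit `1`. There is a dimension for each pair of groups.
The dimension `(i, i)` allows one item of group `i`. In the dimension `(i, i')` an item of group `i`
costs the number `f` whose bits are its values at the variables that both groups share, and an item
of group `i'` costs the complement of its number `f'`, so that the budget enforces `f ≤ f'`; with
the dimension `(i', i)` the two items agree on all shared variables. (Both costs carry a leading
bit `1`, for which the budget leaves room.) An assignment that satisfies
`φ` thus gives a solution of profit `k` (`le_opt_of_sat`), and the items of any solution of profit
at least `ρ k` fit together to an assignment that satisfies at least `(1 - ε) m` clauses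
(`le_sat_of_isSolution`).

The instance has size `N = 2 ^ O(n / k)`, up to factors that depend on `d` only, where the constant
in the exponent does not depend on `d`. Time `N ^ (δ' √d)` is therefore `2 ^ O(δ' n)`, which is
`O(2 ^ (δ n))` for a small constant `δ'`; and the reduction itself is fast enough once `k` is large.

For the running time of the reduction, `PolyTime e f` says that `f` is computed by a program in time
polynomial in the input size plus an allowance `e`, and this notion is closed under the operations
of a small functional language (pairs, case distinction, iteration over lists). Everything that
depends on `d` is a part of the input of one fixed program (`Layout`), so that the degree of the
polynomial does not depend on `d`. The only superpolynomial step is the enumeration of the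
assignments of a group, for which the allowance is their number (`numAssocs`).
-/

namespace VK

/-! ### Relocating programs -/

/-- The program that works on the variables `c, c + 1, …` instead of `0, 1, …`. -/
def Prog.shift (c : ℕ) : Prog → Prog
  | .setNil x => .setNil (c + x)
  | .copy x y => .copy (c + x) (c + y)
  | .setCons x y z => .setCons (c + x) (c + y) (c + z)
  | .setFst x y => .setFst (c + x) (c + y)
  | .setSnd x y => .setSnd (c + x) (c + y)
  | .seq p q => .seq (p.shift c) (q.shift c)
  | .branch x p q => .branch (c + x) (p.shift c) (q.shift c)
  | .loop x p => .loop (c + x) (p.shift c)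

/-- A number above all variables that the program mentions. -/
def Prog.bound : Prog → ℕ
  | .setNil x => x + 1
  | .copy x y => x + y + 1
  | .setCons x y z => x + y + z + 1
  | .setFst x y => x + y + 1
  | .setSnd x y => x + y + 1
  | .seq p q => p.bound + q.bound
  | .branch x p q => x + p.bound + q.bound
  | .loop x p => x + p.bound

/-- The memory state that agrees with `S` below `c` and holds a copy of `s` from `c` on. -/
def graft (c : ℕ) (S s : Store) : Store := fun i => if i < c then S i else s (i - c)

theorem graft_add (c : ℕ) (S s : Store) (i : ℕ) : graft c S s (c + i) = s i := by
  simp [graft]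

theorem graft_of_lt {c i : ℕ} (S s : Store) (h : i < c) : graft c S s i = S i := by
  simp [graft, h]

theorem update_graft (c : ℕ) (S s : Store) (x : ℕ) (v : Data) :
    Function.update (graft c S s) (c + x) v = graft c S (Function.update s x v) := by
  funext i
  by_cases h : i < c
  · have : i ≠ c + x := by omega
    simp [graft, h, this]
  · by_cases h' : i = c + x
    · subst h'; simp [graft]
    · have : i - c ≠ x := by omega
      simp [graft, h, this, h']

theorem graft_eta (c : ℕ) (S : Store) : graft c S (fun i => S (c + i)) = S := by
  funext i
  by_cases h : i < c
  · simp [graft, h]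
  · simp only [graft, h, if_false]; congr 1; omega

theorem Exec.shift {p : Prog} {s s' : Store} {t : ℕ} (h : Exec p s t s') (c : ℕ) (S : Store) :
    Exec (p.shift c) (graft c S s) t (graft c S s') := by
  induction h with
  | setNil x s => rw [← update_graft]; exact Exec.setNil _ _
  | copy x y s => rw [← update_graft, ← graft_add c S s y]; exact Exec.copy _ _ _
  | setCons x y z s =>
    rw [← update_graft, ← graft_add c S s y, ← graft_add c S s z]; exact Exec.setCons _ _ _ _
  | setFst x y s => rw [← update_graft, ← graft_add c S s y]; exact Exec.setFst _ _ _
  | setSnd x y s => rw [← update_graft, ← graft_add c S s y]; exact Exec.setSnd _ _ _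
  | seq _ _ ih ih' => exact Exec.seq ih ih'
  | branchTrue hx _ ih => exact Exec.branchTrue (by rwa [graft_add]) ih
  | branchFalse hx _ ih => exact Exec.branchFalse (by rwa [graft_add]) ih
  | loopDone hx => exact Exec.loopDone (by rwa [graft_add])
  | loopStep hx _ _ ih ih' => exact Exec.loopStep (by rwa [graft_add]) ih ih'

theorem Exec.eq_of_bound_le {p : Prog} {s s' : Store} {t : ℕ} (h : Exec p s t s') :
    ∀ i, p.bound ≤ i → s' i = s i := by
  induction h with
  | setNil | copy | setCons | setFst | setSnd =>
    intro i hi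
    simp only [Prog.bound] at hi
    exact Function.update_of_ne (by omega) _ _
  | seq _ _ ih ih' =>
    intro i hi
    simp only [Prog.bound] at hi
    rw [ih' i (by omega), ih i (by omega)]
  | branchTrue _ _ ih | branchFalse _ _ ih =>
    intro i hi
    simp only [Prog.bound] at hi
    exact ih i (by omega)
  | loopDone => intro i _; rfl
  | loopStep _ _ _ ih ih' =>
    intro i hi
    rw [ih' i hi]
    simp only [Prog.bound] at hi
    exact ih i (by omega)

/-! ### Encodings and computed functions -/

/-- Types whose elements are represented by trees. -/
class Enc (α : Type) where
  /-- The tree that represents an element. -/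
  enc : α → Data

open Enc (enc)

instance : Enc Bool := ⟨Data.ofBool⟩

instance {α β : Type} [Enc α] [Enc β] : Enc (α × β) := ⟨fun p => Data.cons (enc p.1) (enc p.2)⟩

instance {α : Type} [Enc α] : Enc (List α) := ⟨fun l => Data.ofList (l.map enc)⟩

/-- The size of the encoding of an element. -/
def esize {α : Type} [Enc α] (a : α) : ℕ := (enc a).size

section Enc

variable {α β : Type} [Enc α] [Enc β]

theorem enc_pair (a : α) (b : β) : enc (a, b) = Data.cons (enc a) (enc b) := rfl

theorem enc_cons (a : α) (l : List α) : enc (a :: l) = Data.cons (enc a) (enc l) := rfl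

theorem esize_pair (a : α) (b : β) : esize (a, b) = 1 + esize a + esize b := rfl

theorem esize_nil : esize ([] : List α) = 1 := rfl

theorem esize_cons (a : α) (l : List α) : esize (a :: l) = 1 + esize a + esize l := rfl

theorem esize_bool_le (b : Bool) : esize b ≤ 3 := by
  cases b <;> simp [esize, enc, Data.ofBool, Data.size]

theorem Data.size_pos (x : Data) : 1 ≤ x.size := by
  cases x <;> simp only [Data.size] <;> omega

theorem esize_pos (a : α) : 1 ≤ esize a := Data.size_pos _

theorem esize_append (l l' : List α) : esize (l ++ l') + 1 = esize l + esize l' := by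
  induction l with
  | nil => rw [List.nil_append, esize_nil]; omega
  | cons a l ih => rw [List.cons_append, esize_cons, esize_cons]; omega

theorem length_lt_esize (l : List α) : l.length < esize l := by
  induction l with
  | nil => simp [esize_nil]
  | cons a l ih => rw [List.length_cons, esize_cons]; omega

theorem esize_le_of_mem {a : α} {l : List α} (h : a ∈ l) : esize a ≤ esize l := by
  induction l with
  | nil => simp at h
  | cons b l ih =>
    rw [esize_cons]
    rcases List.mem_cons.1 h with rfl | h
    · omega
    · have := ih h; omega

theorem esize_le_of_forall {l : List α} {c : ℕ} (h : ∀ a ∈ l, esize a ≤ c) :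
    esize l ≤ 1 + l.length * (1 + c) := by
  induction l with
  | nil => simp [esize_nil]
  | cons a l ih =>
    rw [esize_cons, List.length_cons]
    have h1 := h a (by simp)
    have h2 := ih fun b hb => h b (by simp [hb])
    linarith

end Enc

/-- Program `p`, started in memory state `s`, halts within `T` steps in a state that satisfies
`Q`. -/
def Steps (p : Prog) (s : Store) (T : ℕ) (Q : Store → Prop) : Prop :=
  ∃ (t : ℕ) (s' : Store), Exec p s t s' ∧ t ≤ T ∧ Q s'

namespace Steps

variable {p q : Prog} {s : Store} {T T' : ℕ} {Q Q' : Store → Prop} {x y z : ℕ}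

theorem mono (h : Steps p s T Q) (hT : T ≤ T') (hQ : ∀ s', Q s' → Q' s') : Steps p s T' Q' := by
  obtain ⟨t, s', he, ht, hq⟩ := h
  exact ⟨t, s', he, ht.trans hT, hQ s' hq⟩

theorem setNil (h : Q (Function.update s x Data.nil)) : Steps (.setNil x) s 1 Q :=
  ⟨1, _, Exec.setNil x s, le_rfl, h⟩

theorem copy (h : Q (Function.update s x (s y))) : Steps (.copy x y) s 1 Q :=
  ⟨1, _, Exec.copy x y s, le_rfl, h⟩

theorem setCons (h : Q (Function.update s x (Data.cons (s y) (s z)))) :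
    Steps (.setCons x y z) s 1 Q :=
  ⟨1, _, Exec.setCons x y z s, le_rfl, h⟩

theorem setFst (h : Q (Function.update s x (s y).fst)) : Steps (.setFst x y) s 1 Q :=
  ⟨1, _, Exec.setFst x y s, le_rfl, h⟩

theorem setSnd (h : Q (Function.update s x (s y).snd)) : Steps (.setSnd x y) s 1 Q :=
  ⟨1, _, Exec.setSnd x y s, le_rfl, h⟩

theorem seq (h : Steps p s T fun s' => Steps q s' T' Q) : Steps (.seq p q) s (T + T') Q := by
  obtain ⟨t, s', he, ht, t', s'', he', ht', hq⟩ := h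
  exact ⟨t + t', s'', Exec.seq he he', by omega, hq⟩

theorem branch (h : s x ≠ Data.nil → Steps p s T Q) (h' : s x = Data.nil → Steps q s T Q) :
    Steps (.branch x p q) s (1 + T) Q := by
  by_cases hx : s x = Data.nil
  · obtain ⟨t, s', he, ht, hq⟩ := h' hx
    exact ⟨1 + t, s', Exec.branchFalse hx he, by omega, hq⟩
  · obtain ⟨t, s', he, ht, hq⟩ := h hx
    exact ⟨1 + t, s', Exec.branchTrue hx he, by omega, hq⟩

theorem loopStep (hx : s x ≠ Data.nil)
    (h : Steps p s T fun s' => Steps (.loop x p) s' T' Q) :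
    Steps (.loop x p) s (1 + T + T') Q := by
  obtain ⟨t, s', he, ht, t', s'', he', ht', hq⟩ := h
  exact ⟨1 + t + t', s'', Exec.loopStep hx he he', by omega, hq⟩

theorem loopDone (hx : s x = Data.nil) (h : Q s) : Steps (.loop x p) s 1 Q :=
  ⟨1, s, Exec.loopDone hx, le_rfl, h⟩

/-- A program that is shifted by `c` works on the memory from `c` on, and leaves the rest alone. -/
theorem shift {c : ℕ} {R : Store → Prop} (h : Steps p (fun i => s (c + i)) T R)
    (hQ : ∀ s', R (fun i => s' (c + i)) → (∀ i < c, s' i = s i) → Q s') :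
    Steps (p.shift c) s T Q := by
  obtain ⟨t, s', he, ht, hs⟩ := h
  refine ⟨t, graft c s s', ?_, ht, hQ _ ?_ fun i hi => graft_of_lt _ _ hi⟩
  · have := he.shift c s
    rwa [graft_eta] at this
  · simpa only [graft_add] using hs

end Steps

/-- Program `p` computes `f` in variable `0`, on the encodings and within time `T`, whatever the
other variables hold at the start. -/
def Computes {α β : Type} [Enc α] [Enc β] (p : Prog) (f : α → β) (T : α → ℕ) : Prop :=
  ∀ (a : α) (s : Store), s 0 = enc a → Steps p s (T a) fun s' => s' 0 = enc (f a)

/-- Shifted by `c`, a program serves as a subroutine with argument and result in variable `c`,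
which leaves the variables below `c` alone. -/
theorem Computes.call {α β : Type} [Enc α] [Enc β] {p : Prog} {f : α → β} {T : α → ℕ}
    (h : Computes p f T) {c : ℕ} {S : Store} {a : α} {Q : Store → Prop} (hc : S c = enc a)
    (hQ : ∀ S', S' c = enc (f a) → (∀ i < c, S' i = S i) → Q S') :
    Steps (p.shift c) S (T a) Q :=
  (h a _ hc).shift hQ

/-! ### Polynomial bounds -/

/-- `g` is bounded by a polynomial in `μ`. -/
def PolyBdd {ι : Type} (μ g : ι → ℕ) : Prop := ∃ C : ℕ, ∀ i, g i ≤ (μ i + 2) ^ C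

namespace PolyBdd

variable {ι κ : Type} {μ g h : ι → ℕ}

theorem mono (hh : PolyBdd μ h) (hg : ∀ i, g i ≤ h i) : PolyBdd μ g :=
  hh.imp fun _ hC i => (hg i).trans (hC i)

theorem const (c : ℕ) : PolyBdd μ fun _ => c :=
  ⟨c, fun _ => (Nat.lt_two_pow_self).le.trans (Nat.pow_le_pow_left (by omega) _)⟩

theorem self : PolyBdd μ μ := ⟨1, fun i => by rw [pow_one]; omega⟩

theorem mul (hg : PolyBdd μ g) (hh : PolyBdd μ h) : PolyBdd μ fun i => g i * h i := by
  obtain ⟨C, hC⟩ := hg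
  obtain ⟨C', hC'⟩ := hh
  exact ⟨C + C', fun i => by rw [pow_add]; exact Nat.mul_le_mul (hC i) (hC' i)⟩

theorem add (hg : PolyBdd μ g) (hh : PolyBdd μ h) : PolyBdd μ fun i => g i + h i := by
  obtain ⟨C, hC⟩ := hg
  obtain ⟨C', hC'⟩ := hh
  refine ⟨C + C' + 1, fun i => ?_⟩
  have h1 : (μ i + 2) ^ C ≤ (μ i + 2) ^ (C + C') := Nat.pow_le_pow_right (by omega) (by omega)
  have h2 : (μ i + 2) ^ C' ≤ (μ i + 2) ^ (C + C') := Nat.pow_le_pow_right (by omega) (by omega)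
  calc g i + h i ≤ (μ i + 2) ^ (C + C') * 2 := by
        have := hC i; have := hC' i; omega
    _ ≤ _ := by rw [pow_succ]; exact Nat.mul_le_mul_left _ (by omega)

theorem pow (hg : PolyBdd μ g) (c : ℕ) : PolyBdd μ fun i => g i ^ c := by
  obtain ⟨C, hC⟩ := hg
  exact ⟨C * c, fun i => by rw [pow_mul]; exact Nat.pow_le_pow_left (hC i) _⟩

theorem comp {ν k : κ → ℕ} {f : ι → κ} (hk : PolyBdd ν k) (hf : PolyBdd μ fun i => ν (f i)) :
    PolyBdd μ fun i => k (f i) := by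
  obtain ⟨C, hC⟩ := hk
  exact ((hf.add (const 2)).pow C).mono fun i => hC (f i)

/-- Over a family of points `j` that lie over `i`, a bound that is polynomial in a quantity which
is itself polynomially bounded in `μ i`. -/
theorem lift {ν k : κ → ℕ} {R : ι → κ → Prop} (hk : PolyBdd ν k) (hh : PolyBdd μ h)
    (hR : ∀ i j, R i j → ν j ≤ h i) :
    ∃ g : ι → ℕ, PolyBdd μ g ∧ ∀ i j, R i j → k j ≤ g i := by
  obtain ⟨C, hC⟩ := hk
  refine ⟨_, (hh.add (const 2)).pow C, fun i j hij => (hC j).trans ?_⟩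
  exact Nat.pow_le_pow_left (by have := hR i j hij; omega) _

end PolyBdd

/-! ### Polynomial-time functions -/

/-- `f` is computed by a program whose running time, and whose output size, is polynomial in the
size of the argument `a` plus the extra allowance `e a`. -/
def PolyTime {α β : Type} [Enc α] [Enc β] (e : α → ℕ) (f : α → β) : Prop :=
  ∃ (p : Prog) (T : α → ℕ), Computes p f T ∧ PolyBdd (fun a => esize a + e a) T ∧
    PolyBdd (fun a => esize a + e a) fun a => esize (f a)

namespace PolyTime

variable {α β γ : Type} [Enc α] [Enc β] [Enc γ] {e : α → ℕ}

theorem polyBdd_esize {f : α → β} (h : PolyTime e f) :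
    PolyBdd (fun a => esize a + e a) fun a => esize (f a) := by
  obtain ⟨_, _, _, _, h⟩ := h
  exact h

/-- Functions that do nothing to the encoding. -/
theorem recode {f : α → β} (h : ∀ a, enc (f a) = enc a) : PolyTime e f := by
  refine ⟨.copy 0 0, fun _ => 1, fun a s hs => Steps.copy ?_, .const 1, ?_⟩
  · simp [hs, h]
  · exact PolyBdd.self.mono fun a => by simp only [esize, h]; omega

theorem id : PolyTime e fun a : α => a := recode fun _ => rfl

theorem comp' {e' : β → ℕ} {f : α → β} {g : β → γ} (hg : PolyTime e' g) (hf : PolyTime e f)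
    (he : PolyBdd (fun a => esize a + e a) fun a => e' (f a)) : PolyTime e fun a => g (f a) := by
  obtain ⟨p, T, hp, hT, hs⟩ := hf
  obtain ⟨q, T', hq, hT', hs'⟩ := hg
  refine ⟨.seq p q, fun a => T a + T' (f a), fun a s h => ?_, hT.add (hT'.comp (hs.add he)),
    hs'.comp (f := f) (hs.add he)⟩
  exact Steps.seq ((hp a s h).mono le_rfl fun s' h' => hq _ _ h')

theorem comp {f : α → β} {g : β → γ} (hg : PolyTime (fun _ => 0) g) (hf : PolyTime e f) :
    PolyTime e fun a => g (f a) :=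
  comp' hg hf (.const 0)

/-- A larger allowance. -/
theorem of_le {e' : α → ℕ} {f : α → β} (hf : PolyTime e' f)
    (he : PolyBdd (fun a => esize a + e a) e') : PolyTime e f :=
  comp' hf id he

/-- The program that writes a given tree. -/
theorem exists_prog_const (v : Data) :
    ∃ (p : Prog) (T : ℕ), ∀ s, Steps p s T fun s' => s' 0 = v := by
  induction v with
  | nil => exact ⟨.setNil 0, 1, fun s => Steps.setNil (by simp)⟩
  | cons a b iha ihb =>
    obtain ⟨p, T, hp⟩ := iha
    obtain ⟨q, T', hq⟩ := ihb
    refine ⟨.seq p (.seq (q.shift 1) (.setCons 0 0 1)), T + (T' + 1), fun s => Steps.seq ?_⟩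
    refine (hp s).mono le_rfl fun s' h' => Steps.seq ?_
    refine (hq _).shift fun s'' h1 h2 => Steps.setCons ?_
    have := h2 0 (by omega)
    simp_all

theorem const (b : β) : PolyTime e fun _ : α => b := by
  obtain ⟨p, T, hp⟩ := exists_prog_const (enc b)
  exact ⟨p, fun _ => T, fun _ s _ => hp s, .const T, .const _⟩

theorem pair {f : α → β} {g : α → γ} (hf : PolyTime e f) (hg : PolyTime e g) :
    PolyTime e fun a => (f a, g a) := by
  obtain ⟨p, T, hp, hT, hs⟩ := hf
  obtain ⟨q, T', hq, hT', hs'⟩ := hg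
  refine ⟨.seq (.copy 1 0) (.seq (p.shift 1) (.seq (.copy 2 0) (.seq (q.shift 2)
    (.setCons 0 1 2)))), fun a => 1 + (T a + (1 + (T' a + 1))), fun a s h => ?_,
    (PolyBdd.const 1).add (hT.add ((PolyBdd.const 1).add (hT'.add (.const 1)))),
    ((PolyBdd.const 1).add hs).add hs'⟩
  refine Steps.seq (Steps.copy (Steps.seq (hp.call (a := a) (by simpa using h)
    fun S h1 h2 => Steps.seq (Steps.copy (Steps.seq (hq.call (a := a) ?_
    fun S' h3 h4 => Steps.setCons ?_))))))
  · have := h2 0 (by omega)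
    simp_all
  · have := h4 1 (by omega)
    simp_all [enc_pair]

theorem fst {f : α → β × γ} (hf : PolyTime e f) : PolyTime e fun a => (f a).1 := by
  refine comp (g := Prod.fst) ⟨.setFst 0 0, fun _ => 1, fun a s hs => Steps.setFst ?_,
    .const 1, ?_⟩ hf
  · simp only [hs, Function.update_self]; rfl
  · exact PolyBdd.self.mono fun a => by
      have := esize_pair a.1 a.2
      simp only [Prod.eta] at this
      omega

theorem snd {f : α → β × γ} (hf : PolyTime e f) : PolyTime e fun a => (f a).2 := by
  refine comp (g := Prod.snd) ⟨.setSnd 0 0, fun _ => 1, fun a s hs => Steps.setSnd ?_,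
    .const 1, ?_⟩ hf
  · simp only [hs, Function.update_self]; rfl
  · exact PolyBdd.self.mono fun a => by
      have := esize_pair a.1 a.2
      simp only [Prod.eta] at this
      omega

theorem cons {f : α → β} {g : α → List β} (hf : PolyTime e f) (hg : PolyTime e g) :
    PolyTime e fun a => f a :: g a :=
  comp (g := fun p : β × List β => p.1 :: p.2) (recode fun _ => rfl) (hf.pair hg)

theorem tail {f : α → List β} (hf : PolyTime e f) : PolyTime e fun a => (f a).tail := by
  refine comp (g := List.tail) ⟨.setSnd 0 0, fun _ => 1, fun a s hs => Steps.setSnd ?_,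
    .const 1, ?_⟩ hf
  · simp only [hs, Function.update_self]; cases a <;> rfl
  · refine PolyBdd.self.mono fun a => ?_
    cases a
    · simp
    · simp only [List.tail_cons, esize_cons]; omega

theorem headD {f : α → List Bool} (hf : PolyTime e f) :
    PolyTime e fun a => (f a).headD false := by
  refine comp (g := fun l : List Bool => l.headD false) ⟨.setFst 0 0, fun _ => 1,
    fun a s hs => Steps.setFst ?_, .const 1, ?_⟩ hf
  · simp only [hs, Function.update_self]; cases a <;> rfl
  · exact (PolyBdd.const 3).mono fun a => esize_bool_le _

theorem enc_true_ne : enc true ≠ Data.nil := by simp [enc, Data.ofBool]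

theorem ite {b : α → Bool} {f g : α → β} (hb : PolyTime e b) (hf : PolyTime e f)
    (hg : PolyTime e g) : PolyTime e fun a => if b a then f a else g a := by
  obtain ⟨p, T, hp, hT, hs⟩ := hf
  obtain ⟨q, T', hq, hT', hs'⟩ := hg
  obtain ⟨r, T'', hr, hT'', hs''⟩ := hb
  refine ⟨.seq (.copy 1 0) (.seq (r.shift 1) (.branch 1 p q)),
    fun a => 1 + (T'' a + (1 + (T a + T' a))), fun a s h => ?_,
    (PolyBdd.const 1).add (hT''.add ((PolyBdd.const 1).add (hT.add hT'))),
    (hs.add hs').mono fun a => by dsimp only; split <;> omega⟩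
  refine Steps.seq (Steps.copy (Steps.seq (hr.call (a := a) (by simpa using h)
    fun S h1 h2 => Steps.branch (fun hx => ?_) fun hx => ?_)))
  · have h0 : S 0 = enc a := by simpa [h] using h2 0 (by omega)
    have hba : b a = true := by
      by_contra hc
      rw [h1, Bool.eq_false_iff.2 hc] at hx
      exact hx rfl
    refine (hp a S h0).mono (by omega) fun s' h' => ?_
    simp [h', hba]
  · have h0 : S 0 = enc a := by simpa [h] using h2 0 (by omega)
    have hba : b a = false := by
      by_contra hc
      rw [Bool.not_eq_false] at hc
      rw [h1, hc] at hx
      exact enc_true_ne hx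
    refine (hq a S h0).mono (by omega) fun s' h' => ?_
    simp [h', hba]

theorem isEmpty {f : α → List β} (hf : PolyTime e f) : PolyTime e fun a => (f a).isEmpty := by
  refine comp (g := List.isEmpty) ⟨.branch 0 (.setNil 0) (.seq (.setNil 0) (.setCons 0 0 0)),
    fun _ => 1 + (1 + 1), fun a s hs => Steps.branch (fun hx => ?_) fun hx => ?_,
    .const _, (PolyBdd.const 3).mono fun a => esize_bool_le _⟩ hf
  · refine (Steps.setNil (Q := fun s' => s' 0 = Data.nil) (by simp)).mono (by omega)
      fun s' h => ?_
    cases a with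
    | nil => exact absurd hs hx
    | cons a l => exact h
  · refine Steps.seq (Steps.setNil (Steps.setCons ?_))
    cases a with
    | nil => simp [enc, Data.ofBool]
    | cons a l => rw [hs, enc_cons] at hx; cases hx

/-- The program of a loop over a list: variable `0` holds the parameter, `1` the rest of the list,
`2` the accumulator. -/
theorem steps_foldl {q : Prog} {g : α → β → γ → β} {T : α × β × γ → ℕ}
    (hq : Computes q (fun p : α × β × γ => g p.1 p.2.1 p.2.2) T) (a : α) (B : ℕ) (l : List γ) :
    ∀ (b : β) (s : Store), s 0 = enc a → s 1 = enc l → s 2 = enc b →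
      (∀ l' x, l' ++ [x] <+: l → T (a, l'.foldl (g a) b, x) ≤ B) →
      Steps (.loop 1 (.seq (.setFst 3 1) (.seq (.setCons 3 2 3) (.seq (.setCons 3 0 3)
        (.seq (q.shift 3) (.seq (.copy 2 3) (.setSnd 1 1))))))) s (l.length * (B + 6) + 1)
        fun s' => s' 2 = enc (l.foldl (g a) b) := by
  induction l with
  | nil =>
    intro b s _ h1 h2 _
    exact (Steps.loopDone (Q := fun s' => s' 2 = enc b) h1 h2).mono (by omega) fun _ h => h
  | cons x l ih =>
    intro b s h0 h1 h2 hB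
    have hx : T (a, b, x) ≤ B := hB [] x (by simp)
    rw [enc_cons] at h1
    refine (Steps.loopStep (T := 1 + (1 + (1 + (T (a, b, x) + (1 + 1)))))
      (T' := l.length * (B + 6) + 1) (by rw [h1]; simp) ?_).mono
      (by rw [List.length_cons, add_mul]; omega) fun _ h => h
    refine Steps.seq (Steps.setFst (Steps.seq (Steps.setCons (Steps.seq (Steps.setCons
      (Steps.seq (hq.call (a := (a, b, x)) ?_ fun S h3 h4 => Steps.seq (Steps.copy
      (Steps.setSnd ?_)))))))))
    · simp [h0, h1, h2, enc_pair, Data.fst]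
    · have h40 := h4 0 (by omega)
      have h41 := h4 1 (by omega)
      refine ih (g a b x) _ ?_ ?_ ?_ fun l' y hy => hB (x :: l') y ?_
      · simpa [h0] using h40
      · simp [h41, h1, Data.snd]
      · simp [h3]
      · simpa using hy

/-- Iteration over a list. The bound `h` has to control the accumulator, and the allowance that
the step function needs, at the points that the iteration visits. -/
theorem foldl' {e' : α × β × γ → ℕ} {l : α → List γ} {i : α → β} {g : α → β → γ → β} {h : α → ℕ}
    (hl : PolyTime e l) (hi : PolyTime e i)
    (hg : PolyTime e' fun p : α × β × γ => g p.1 p.2.1 p.2.2)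
    (hh : PolyBdd (fun a => esize a + e a) h)
    (hacc : ∀ a l', l' <+: l a → esize (l'.foldl (g a) (i a)) ≤ h a)
    (he : ∀ a l' x, l' ++ [x] <+: l a → e' (a, l'.foldl (g a) (i a), x) ≤ h a) :
    PolyTime e fun a => (l a).foldl (g a) (i a) := by
  obtain ⟨p, T, hp, hT, hs⟩ := hl
  obtain ⟨q, T', hq, hT', hs'⟩ := hi
  obtain ⟨r, T'', hr, hT'', hs''⟩ := hg
  have hself : PolyBdd (fun a => esize a + e a) fun a => esize a :=
    PolyBdd.self.mono fun a => by omega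
  obtain ⟨B, hB, hB'⟩ := hT''.lift (R := fun a y => ∃ l' x, l' ++ [x] <+: l a ∧
      y = (a, l'.foldl (g a) (i a), x))
    (h := fun a => 2 + esize a + h a + esize (l a) + h a)
    (((((PolyBdd.const 2).add hself).add hh).add hs).add hh) <| by
      rintro a _ ⟨l', x, hx, rfl⟩
      have h1 := hacc a l' ((List.prefix_append _ _).trans hx)
      have h2 := he a l' x hx
      have h3 : esize x ≤ esize (l a) := esize_le_of_mem (hx.subset (by simp))
      simp only [esize_pair]
      omega
  refine ⟨.seq (.copy 1 0) (.seq (p.shift 1) (.seq (.copy 2 0) (.seq (q.shift 2) (.seq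
    (.loop 1 (.seq (.setFst 3 1) (.seq (.setCons 3 2 3) (.seq (.setCons 3 0 3)
        (.seq (r.shift 3) (.seq (.copy 2 3) (.setSnd 1 1))))))) (.copy 0 2))))),
    fun a => 1 + (T a + (1 + (T' a + ((l a).length * (B a + 6) + 1 + 1)))), fun a s h0 => ?_,
    (PolyBdd.const 1).add (hT.add ((PolyBdd.const 1).add (hT'.add ((((hs.mono
      fun a => (length_lt_esize (l a)).le).mul (hB.add (.const 6))).add (.const 1)).add
      (.const 1))))), hh.mono fun a => hacc a _ (List.prefix_refl _)⟩
  refine Steps.seq (Steps.copy (Steps.seq (hp.call (a := a) (by simpa using h0)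
    fun S h1 h2 => Steps.seq (Steps.copy (Steps.seq (hq.call (a := a) ?_
    fun S' h3 h4 => Steps.seq ((steps_foldl hr a (B a) (l a) (i a) S' ?_ ?_ h3 ?_).mono le_rfl
    fun s' h' => Steps.copy (by simpa using h'))))))))
  · have := h2 0 (by omega)
    simp_all
  · have := h2 0 (by omega)
    have := h4 0 (by omega)
    simp_all
  · have := h4 1 (by omega)
    simp_all
  · exact fun l' x hx => hB' a _ ⟨l', x, hx, rfl⟩

/-- Iteration over a list whose accumulator grows by a bounded amount in each step. -/
theorem foldl_of_growth {e' : α × β × γ → ℕ} {l : α → List γ} {i : α → β} {g : α → β → γ → β}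
    {h : α → ℕ} (hl : PolyTime e l) (hi : PolyTime e i)
    (hg : PolyTime e' fun p : α × β × γ => g p.1 p.2.1 p.2.2)
    (hh : PolyBdd (fun a => esize a + e a) h)
    (hacc : ∀ a b x, x ∈ l a → esize (g a b x) ≤ esize b + h a)
    (he : ∀ a b x, x ∈ l a → e' (a, b, x) ≤ h a) :
    PolyTime e fun a => (l a).foldl (g a) (i a) := by
  have key : ∀ a l', l' <+: l a →
      esize (l'.foldl (g a) (i a)) ≤ esize (i a) + l'.length * h a := by
    intro a l'
    induction l' using List.reverseRecOn with
    | nil => intro _; simp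
    | append_singleton l' x ih =>
      intro hx
      have h1 := ih ((List.prefix_append _ _).trans hx)
      rw [List.foldl_append, List.foldl_cons, List.foldl_nil]
      have h2 := hacc a (l'.foldl (g a) (i a)) x (hx.subset (by simp))
      rw [List.length_append, List.length_singleton, add_mul]
      omega
  refine foldl' (h := fun a => esize (i a) + esize (l a) * h a + h a) hl hi hg
    ((hi.polyBdd_esize.add (hl.polyBdd_esize.mul hh)).add hh) (fun a l' hl' => ?_)
    fun a l' x hx => ?_
  · refine (key a l' hl').trans ?_
    have := Nat.mul_le_mul_right (h a) (hl'.length_le.trans (length_lt_esize (l a)).le)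
    omega
  · have := he a (l'.foldl (g a) (i a)) x (hx.subset (by simp))
    omega

end PolyTime

/-! ### Polynomial-time operations on truth values and lists -/

namespace PolyTime

variable {α β γ : Type} [Enc α] [Enc β] [Enc γ] {e : α → ℕ}

theorem congr {f g : α → β} (hf : PolyTime e f) (h : ∀ a, f a = g a) : PolyTime e g := by
  rwa [show g = f from funext fun a => (h a).symm]

theorem and {b c : α → Bool} (hb : PolyTime e b) (hc : PolyTime e c) :
    PolyTime e fun a => b a && c a :=
  (hb.ite hc (const false)).congr fun a => by cases b a <;> simp

theorem or {b c : α → Bool} (hb : PolyTime e b) (hc : PolyTime e c) :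
    PolyTime e fun a => b a || c a :=
  (hb.ite (const true) hc).congr fun a => by cases b a <;> simp

theorem not {b : α → Bool} (hb : PolyTime e b) : PolyTime e fun a => !b a :=
  (hb.ite (const false) (const true)).congr fun a => by cases b a <;> simp

theorem xor {b c : α → Bool} (hb : PolyTime e b) (hc : PolyTime e c) :
    PolyTime e fun a => b a ^^ c a :=
  (hb.ite hc.not hc).congr fun a => by cases b a <;> simp

theorem polyBdd_allowance : PolyBdd (fun a => esize a + e a) e :=
  PolyBdd.self.mono fun a => by omega

/-- Iteration over a list with a truth value as accumulator. -/
theorem foldl_bool {l : α → List γ} {i : α → Bool} {g : α → Bool → γ → Bool}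
    (hl : PolyTime e l) (hi : PolyTime e i)
    (hg : PolyTime (fun p => e p.1) fun p : α × Bool × γ => g p.1 p.2.1 p.2.2) :
    PolyTime e fun a => (l a).foldl (g a) (i a) :=
  foldl_of_growth (h := fun a => 3 + e a) hl hi hg ((PolyBdd.const 3).add polyBdd_allowance)
    (fun a b x _ => by have := esize_bool_le (g a b x); omega) fun a b x _ => by simp

theorem any {l : α → List γ} {g : α → γ → Bool} (hl : PolyTime e l)
    (hg : PolyTime (fun p => e p.1) fun p : α × γ => g p.1 p.2) :
    PolyTime e fun a => (l a).any (g a) := by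
  refine (foldl_bool (g := fun a b x => b || g a x) hl (const false) (or id.snd.fst
    (comp' hg (id.fst.pair id.snd.snd) polyBdd_allowance))).congr fun a => ?_
  have : ∀ (l : List γ) (b : Bool), l.foldl (fun b x => b || g a x) b = (b || l.any (g a)) := by
    intro l
    induction l with
    | nil => simp
    | cons x l ih => intro b; rw [List.foldl_cons, ih, List.any_cons, Bool.or_assoc]
  simp [this]

theorem all {l : α → List γ} {g : α → γ → Bool} (hl : PolyTime e l)
    (hg : PolyTime (fun p => e p.1) fun p : α × γ => g p.1 p.2) :
    PolyTime e fun a => (l a).all (g a) :=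
  (any hl (g := fun a x => !g a x) hg.not).not.congr fun a => by
    rw [List.all_eq_not_any_not]

/-- The results of `g` on the elements of a list `l a` have sizes with a common polynomial bound. -/
theorem exists_esize_le_of_mem {e' : α × γ → ℕ} {l : α → List γ} {g : α → γ → β} {h : α → ℕ}
    (hl : PolyTime e l) (hg : PolyTime e' fun p : α × γ => g p.1 p.2)
    (hh : PolyBdd (fun a => esize a + e a) h) (he : ∀ a, ∀ x ∈ l a, e' (a, x) ≤ h a) :
    ∃ h' : α → ℕ, PolyBdd (fun a => esize a + e a) h' ∧
      ∀ a, ∀ x ∈ l a, esize (g a x) ≤ h' a := by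
  obtain ⟨h', h1, h2⟩ := hg.polyBdd_esize.lift (R := fun a y => ∃ x ∈ l a, y = (a, x))
    (h := fun a => 1 + esize a + esize (l a) + h a)
    ((((PolyBdd.const 1).add (PolyBdd.self.mono fun a => by omega)).add
      hl.polyBdd_esize).add hh) (by
      rintro a _ ⟨x, hx, rfl⟩
      have h1 := he a x hx
      have h2 := esize_le_of_mem hx
      rw [esize_pair]
      omega)
  exact ⟨h', h1, fun a x hx => h2 a _ ⟨x, hx, rfl⟩⟩

theorem reverse {l : α → List γ} (hl : PolyTime e l) : PolyTime e fun a => (l a).reverse := by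
  refine (foldl_of_growth (h := fun a => 1 + esize (l a)) (g := fun _ b x => x :: b)
    (e' := fun _ => 0) hl (const []) (cons id.snd.snd id.snd.fst)
    ((PolyBdd.const 1).add hl.polyBdd_esize) (fun a b x hx => ?_) fun _ _ _ _ => by simp).congr
    fun a => by simp
  rw [esize_cons]
  have := esize_le_of_mem hx
  omega

theorem append {l l' : α → List γ} (hl : PolyTime e l) (hl' : PolyTime e l') :
    PolyTime e fun a => l a ++ l' a := by
  refine (foldl_of_growth (h := fun a => 1 + esize (l a).reverse) (g := fun _ b x => x :: b)
    (e' := fun _ => 0) hl.reverse hl' (cons id.snd.snd id.snd.fst)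
    ((PolyBdd.const 1).add hl.reverse.polyBdd_esize) (fun a b x hx => ?_)
    fun _ _ _ _ => by simp).congr fun a => by simp
  rw [esize_cons]
  have := esize_le_of_mem hx
  omega

/-- Concatenation of lists that are computed with an allowance bounded by `h`. -/
theorem flatMap' {e' : α × γ → ℕ} {l : α → List γ} {g : α → γ → List β} {h : α → ℕ}
    (hl : PolyTime e l) (hg : PolyTime e' fun p : α × γ => g p.1 p.2)
    (hh : PolyBdd (fun a => esize a + e a) h) (he : ∀ a, ∀ x ∈ l a, e' (a, x) ≤ h a) :
    PolyTime e fun a => (l a).flatMap (g a) := by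
  obtain ⟨h', h1, h2⟩ := exists_esize_le_of_mem hl hg hh he
  refine (foldl_of_growth (h := fun a => h' a + h a) (g := fun a b x => b ++ g a x)
    (e' := fun p => e' (p.1, p.2.2)) (i := fun _ => []) hl (const [])
    (append id.snd.fst (comp' hg (id.fst.pair id.snd.snd) polyBdd_allowance)) (h1.add hh)
    (fun a b x hx => ?_) fun a b x hx => ?_).congr fun a => ?_
  · have h3 := h2 a x hx
    have h4 := esize_append b (g a x)
    omega
  · have := he a x hx
    dsimp only
    omega
  · have : ∀ (l : List γ) (b : List β),
        l.foldl (fun b x => b ++ g a x) b = b ++ l.flatMap (g a) := by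
      intro l
      induction l with
      | nil => simp
      | cons x l ih => intro b; simp [ih]
    simp [this]

theorem flatMap {l : α → List γ} {g : α → γ → List β} (hl : PolyTime e l)
    (hg : PolyTime (fun p => e p.1) fun p : α × γ => g p.1 p.2) :
    PolyTime e fun a => (l a).flatMap (g a) :=
  flatMap' hl hg polyBdd_allowance fun _ _ _ => le_rfl

theorem map {l : α → List γ} {g : α → γ → β} (hl : PolyTime e l)
    (hg : PolyTime (fun p => e p.1) fun p : α × γ => g p.1 p.2) :
    PolyTime e fun a => (l a).map (g a) :=
  (flatMap (g := fun a x => [g a x]) hl (cons hg (const []))).congr fun a => by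
    rw [List.map_eq_flatMap]

theorem filter {l : α → List γ} {g : α → γ → Bool} (hl : PolyTime e l)
    (hg : PolyTime (fun p => e p.1) fun p : α × γ => g p.1 p.2) :
    PolyTime e fun a => (l a).filter (g a) :=
  (flatMap (g := fun a x => if g a x then [x] else []) hl
    (ite hg (cons id.snd (const [])) (const []))).congr fun a => by
    induction l a with
    | nil => rfl
    | cons x l ih => rw [List.flatMap_cons, ih, List.filter_cons]; split <;> simp

/-- Comparison of strings of bits. -/
theorem beq {x y : α → List Bool} (hx : PolyTime e x) (hy : PolyTime e y) :
    PolyTime e fun a => x a == y a := by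
  let g : List Bool × Bool → Bool → List Bool × Bool := fun s b =>
    (s.1.tail, s.2 && !s.1.isEmpty && !(s.1.headD false ^^ b))
  have hfold : PolyTime e fun a => (x a).foldl g (y a, true) := by
    refine foldl_of_growth (h := fun _ => 3) (g := fun _ => g) (e' := fun _ => 0) hx
      (hy.pair (const true)) ?_ (.const 3) (fun a b t _ => ?_) fun _ _ _ _ => by simp
    · exact (id.snd.fst.fst.tail).pair ((id.snd.fst.snd.and id.snd.fst.fst.isEmpty.not).and
        (id.snd.fst.fst.headD.xor id.snd.snd).not)
    · obtain ⟨l, c⟩ := b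
      have h1 := esize_bool_le (c && !l.isEmpty && !(l.headD false ^^ t))
      have h2 : esize l.tail ≤ esize l := by
        cases l
        · simp
        · simp only [List.tail_cons, esize_cons]; omega
      simp only [g, esize_pair] at *
      omega
  refine (hfold.snd.and hfold.fst.isEmpty).congr fun a => ?_
  have : ∀ (x y : List Bool) (b : Bool),
      ((x.foldl g (y, b)).2 && (x.foldl g (y, b)).1.isEmpty) = (b && x == y) := by
    intro x
    induction x with
    | nil => intro y b; cases y <;> simp
    | cons c x ih =>
      intro y b
      rw [List.foldl_cons, ih]
      cases y with
      | nil => simp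
      | cons d y => cases c <;> cases d <;> simp
  simp [this]

theorem contains {x : α → List Bool} {l : α → List (List Bool)} (hx : PolyTime e x)
    (hl : PolyTime e l) : PolyTime e fun a => (l a).contains (x a) :=
  (any (g := fun a y => x a == y) hl (beq (comp' hx id.fst polyBdd_allowance) id.snd)).congr
    fun a => by rw [List.contains_eq_any_beq]

end PolyTime

/-! ### The reduction as a function on encoded data -/

/-- A variable, given by the bits of its index. -/
abbrev Name : Type := List Bool

/-- A clause as a list of literals, in the form in which it is encoded. -/
abbrev RawClause : Type := List (Bool × Name)

/-- A total or partial assignment as an association list. -/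
abbrev Assoc : Type := List (Name × Bool)

/-- The names that occur in a list of clauses. -/
def names (C : List RawClause) : List Name := C.flatMap fun c => c.map Prod.snd

/-- Removal of duplicates. -/
def dedupNames (l : List Name) : List Name :=
  l.foldl (fun b x => if b.contains x then b else x :: b) []

/-- The names that occur in a list of clauses, without repetition. -/
def distinctNames (C : List RawClause) : List Name := dedupNames (names C)

/-- One step of `select`: the state is the unread part of the pattern, and the clauses selected
so far. -/
def selectStep (P : List Bool) (s : List Bool × List RawClause) (c : RawClause) :
    List Bool × List RawClause :=
  ((if s.1.isEmpty then P else s.1).tail,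
    if (if s.1.isEmpty then P else s.1).headD false then c :: s.2 else s.2)

/-- The first `P.length` clauses, and those of the others that meet a `true` when the list of
clauses is laid along the periodic repetition of the pattern `P`. -/
def select (P : List Bool) (C : List RawClause) : List RawClause :=
  (C.foldl (selectStep P) (P.map fun _ => true, [])).2

/-- All assignments to the names of `U` that are `false` outside `N`. -/
def partialAssocs (U N : List Name) : List Assoc :=
  U.foldl (fun b u => b.flatMap fun a =>
    if N.contains u then [(u, false) :: a, (u, true) :: a] else [(u, false) :: a]) [[]]

/-- The assignment makes some literal of the clause true. -/
def satisfies (a : Assoc) (c : RawClause) : Bool :=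
  c.any fun l => a.any fun ub => ub.1 == l.2 && !(ub.2 ^^ l.1)

/-- The assignments supported on the names of the clauses that `P` selects which satisfy all
these clauses. -/
def groupAssocs (P : List Bool) (C : List RawClause) : List Assoc :=
  (partialAssocs (distinctNames C) (names (select P C))).filter fun a =>
    (select P C).all fun c => satisfies a c

/-- How to compute a cost from an assignment: `(false, b, _)` stands for the cost `b`, and
`(true, b, P)` for the bits of the assignment at the names of the clauses that `P` selects,
complemented if `b` is true, under a leading bit `1`. The leading bit makes the string the canonical
binary representation of the cost. -/
abbrev CostRule : Type := Bool × Bool × List Bool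

/-- The binary representation of the cost that a rule prescribes. -/
def costBits (C : List RawClause) (a : Assoc) (t : CostRule) : List Bool :=
  if t.1 then (a.map fun ub => t.2.1 ^^ (ub.2 && (names (select t.2.2 C)).contains ub.1)) ++ [true]
  else if t.2.1 then [true] else []

/-- The binary representation of a budget: `2 ^ (u + 1) + 2 ^ u - 1` for a comparison of two
assignments to `u` names, and `1` otherwise. -/
def budgetBits (C : List RawClause) (t : Bool) : List Bool :=
  if t then ((distinctNames C).map fun _ => true) ++ [false, true] else [true]

/-- The items of one group, with profit `1` each. -/
def groupItems (C : List RawClause) (w : List Bool × List CostRule) :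
    List (List Bool × List (List Bool)) :=
  (groupAssocs w.1 C).map fun a => ([true], w.2.map fun t => costBits C a t)

/-- The non-uniform part of the input of the reduction: for each group its pattern and its cost
rules, and the kinds of the budgets. -/
abbrev Layout : Type := List (List Bool × List CostRule) × List Bool

/-- The encoded knapsack instance. -/
def knapsackData (W : Layout) (C : List RawClause) :
    List (List Bool × List (List Bool)) × List (List Bool) :=
  (W.1.flatMap (groupItems C), W.2.map (budgetBits C))

/-- The number of assignments that the construction of one group enumerates. -/
def numAssocs (P : List Bool) (C : List RawClause) : ℕ :=
  2 ^ (distinctNames C).countP fun u => (names (select P C)).contains u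

/-! ### The running time of the reduction -/

theorem polyTime_names : PolyTime (fun _ => 0) names :=
  PolyTime.flatMap (g := fun (_ : List RawClause) (c : RawClause) => c.map Prod.snd) .id
    (PolyTime.map (g := fun (_ : List RawClause × RawClause) (l : Bool × Name) => l.2)
    PolyTime.id.snd PolyTime.id.snd.snd)

theorem polyTime_dedupNames : PolyTime (fun _ => 0) dedupNames := by
  refine PolyTime.foldl_of_growth
    (g := fun (_ b : List Name) (x : Name) => if b.contains x then b else x :: b)
    (h := fun a => 1 + esize a) (e' := fun _ => 0) .id (.const [])
    (PolyTime.ite (PolyTime.contains PolyTime.id.snd.snd PolyTime.id.snd.fst) PolyTime.id.snd.fst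
      (PolyTime.cons PolyTime.id.snd.snd PolyTime.id.snd.fst))
    ((PolyBdd.const 1).add PolyTime.id.polyBdd_esize) (fun a b x hx => ?_) fun _ _ _ _ => by simp
  have := esize_le_of_mem hx
  split
  · omega
  · rw [esize_cons]; omega

theorem polyTime_distinctNames : PolyTime (fun _ => 0) distinctNames :=
  polyTime_dedupNames.comp polyTime_names

theorem polyTime_select :
    PolyTime (fun _ => 0) fun x : List Bool × List RawClause => select x.1 x.2 := by
  refine PolyTime.snd (PolyTime.foldl_of_growth
    (g := fun (a : List Bool × List RawClause) => selectStep a.1)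
    (h := fun a => esize a.1 + esize a.2 + 1) (e' := fun _ => 0)
    PolyTime.id.snd ((PolyTime.map (g := fun _ _ => true) PolyTime.id.fst (.const true)).pair
    (.const [])) ?_ ((PolyTime.id.fst.polyBdd_esize.add PolyTime.id.snd.polyBdd_esize).add
    (.const 1)) (fun a b x hx => ?_) fun _ _ _ _ => by simp)
  · have hr : PolyTime (fun _ => 0) fun p : (List Bool × List RawClause) ×
        (List Bool × List RawClause) × RawClause =>
        if p.2.1.1.isEmpty then p.1.1 else p.2.1.1 :=
      PolyTime.id.snd.fst.fst.isEmpty.ite PolyTime.id.fst.fst PolyTime.id.snd.fst.fst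
    exact hr.tail.pair (hr.headD.ite (.cons PolyTime.id.snd.snd PolyTime.id.snd.fst.snd)
      PolyTime.id.snd.fst.snd)
  · obtain ⟨r, o⟩ := b
    have h1 := esize_le_of_mem hx
    have htail : ∀ l : List Bool, esize l.tail ≤ esize l := by
      intro l
      cases l
      · simp
      · simp only [List.tail_cons, esize_cons]; omega
    have h2 : esize (if r.isEmpty then a.1 else r).tail ≤ esize a.1 + esize r := by
      refine (htail _).trans ?_
      split <;> omega
    have h3 : esize (if (if r.isEmpty then a.1 else r).headD false then x :: o else o) ≤
        1 + esize x + esize o := by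
      generalize (if r.isEmpty then a.1 else r).headD false = b
      cases b
      · simp
      · simp [esize_cons]
    simp only [selectStep, esize_pair] at *
    omega

theorem length_partialAssocs (U N : List Name) :
    (partialAssocs U N).length = 2 ^ U.countP fun u => N.contains u := by
  induction U using List.reverseRecOn with
  | nil => rfl
  | append_singleton U u ih =>
    rw [partialAssocs, List.foldl_append, ← partialAssocs, List.foldl_cons, List.foldl_nil,
      List.length_flatMap, List.countP_append, pow_add, ← ih]
    by_cases h : N.contains u
    · have h' : u ∈ N := by simpa using h
      simp [h', List.map_const', List.sum_replicate]
    · have h' : u ∉ N := by simpa using h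
      simp [h', List.map_const', List.sum_replicate]

theorem esize_le_of_mem_partialAssocs (U N : List Name) :
    ∀ a ∈ partialAssocs U N, esize a ≤ 5 * esize U := by
  induction U using List.reverseRecOn with
  | nil =>
    intro a ha
    have : a = [] := by simpa [partialAssocs] using ha
    subst this
    simp only [esize_nil]
    omega
  | append_singleton U u ih =>
    intro a ha
    rw [partialAssocs, List.foldl_append, ← partialAssocs, List.foldl_cons, List.foldl_nil,
      List.mem_flatMap] at ha
    obtain ⟨a', ha', ha⟩ := ha
    have h1 := ih a' ha'
    have h2 := esize_append U [u]
    rw [esize_cons, esize_nil] at h2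
    have h3 := esize_bool_le true
    have h4 := esize_bool_le false
    have h5 : esize a ≤ 1 + (1 + esize u + 3) + esize a' := by
      split at ha <;> simp only [List.mem_cons, List.not_mem_nil, or_false] at ha
      · rcases ha with rfl | rfl <;> rw [esize_cons, esize_pair] <;> omega
      · subst ha
        rw [esize_cons, esize_pair]
        omega
    omega

theorem polyTime_partialAssocs :
    PolyTime (fun x : List Name × List Name => 2 ^ x.1.countP fun u => x.2.contains u)
      fun x => partialAssocs x.1 x.2 := by
  refine PolyTime.foldl' (h := fun x => 1 + (2 ^ x.1.countP fun u => x.2.contains u) *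
    (1 + 5 * esize x.1)) (e' := fun _ => 0) (i := fun _ => [[]])
    (g := fun (a : List Name × List Name) b u => b.flatMap fun c =>
      if a.2.contains u then [(u, false) :: c, (u, true) :: c] else [(u, false) :: c])
    PolyTime.id.fst (.const [[]]) ?_ ?_ (fun a l' hl => ?_) fun _ _ _ _ => by simp
  · have hc (b : Bool) : PolyTime (fun _ => 0) fun p : ((List Name × List Name) × List Assoc ×
        Name) × Assoc => (p.1.2.2, b) :: p.2 :=
      .cons (PolyTime.id.fst.snd.snd.pair (.const b)) PolyTime.id.snd
    exact PolyTime.flatMap (g := fun (p : (List Name × List Name) × List Assoc × Name) c =>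
      if p.1.2.contains p.2.2 then [(p.2.2, false) :: c, (p.2.2, true) :: c]
      else [(p.2.2, false) :: c]) PolyTime.id.snd.fst
      ((PolyTime.contains PolyTime.id.fst.snd.snd PolyTime.id.fst.fst.snd).ite
      (.cons (hc false) (.cons (hc true) (.const []))) (.cons (hc false) (.const [])))
  · exact (PolyBdd.const 1).add (PolyTime.polyBdd_allowance.mul ((PolyBdd.const 1).add
      ((PolyBdd.const 5).mul PolyTime.id.fst.polyBdd_esize)))
  · change esize (partialAssocs l' a.2) ≤ _
    refine (esize_le_of_forall (esize_le_of_mem_partialAssocs l' a.2)).trans ?_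
    rw [length_partialAssocs]
    obtain ⟨l'', hl⟩ := hl
    have h1 : esize l' ≤ esize a.1 := by
      rw [← hl]
      have := esize_append l' l''
      have := esize_pos l''
      omega
    have h2 : (l'.countP fun u => a.2.contains u) ≤ a.1.countP fun u => a.2.contains u := by
      rw [← hl, List.countP_append]
      omega
    gcongr
    omega

theorem polyTime_satisfies :
    PolyTime (fun _ => 0) fun x : Assoc × RawClause => satisfies x.1 x.2 :=
  PolyTime.any (g := fun (x : Assoc × RawClause) l =>
    x.1.any fun ub => ub.1 == l.2 && !(ub.2 ^^ l.1)) PolyTime.id.snd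
    (PolyTime.any (g := fun (y : (Assoc × RawClause) × Bool × Name) ub =>
      ub.1 == y.2.2 && !(ub.2 ^^ y.2.1)) PolyTime.id.fst.fst
      ((PolyTime.beq PolyTime.id.snd.fst PolyTime.id.fst.snd.snd).and
        (PolyTime.id.snd.snd.xor PolyTime.id.fst.snd.fst).not))

theorem polyTime_groupAssocs :
    PolyTime (fun x : List Bool × List RawClause => numAssocs x.1 x.2)
      fun x => groupAssocs x.1 x.2 := by
  have hs : PolyTime (fun x : List Bool × List RawClause => numAssocs x.1 x.2)
      fun x => select x.1 x.2 := polyTime_select.of_le (.const 0)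
  refine PolyTime.filter (g := fun (x : List Bool × List RawClause) a =>
    (select x.1 x.2).all fun c => satisfies a c)
    (polyTime_partialAssocs.comp' ((polyTime_distinctNames.comp PolyTime.id.snd).pair
      (polyTime_names.comp hs)) ?_) ?_
  · exact PolyTime.polyBdd_allowance
  · refine PolyTime.of_le (e' := fun _ => 0) ?_ (.const 0)
    exact PolyTime.all (g := fun (y : (List Bool × List RawClause) × Assoc) c => satisfies y.2 c)
      (polyTime_select.comp PolyTime.id.fst)
      (polyTime_satisfies.comp (PolyTime.id.fst.snd.pair PolyTime.id.snd))

theorem polyTime_costBits : PolyTime (fun _ => 0)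
    fun x : List RawClause × Assoc × CostRule => costBits x.1 x.2.1 x.2.2 := by
  refine PolyTime.ite PolyTime.id.snd.snd.fst (.append (.map (g :=
    fun (x : List RawClause × Assoc × CostRule) ub =>
      x.2.2.2.1 ^^ (ub.2 && (names (select x.2.2.2.2 x.1)).contains ub.1)) PolyTime.id.snd.fst
    (.xor PolyTime.id.fst.snd.snd.snd.fst (.and PolyTime.id.snd.snd (.contains PolyTime.id.snd.fst
      (polyTime_names.comp (polyTime_select.comp (PolyTime.id.fst.snd.snd.snd.snd.pair
        PolyTime.id.fst.fst))))))) (.const [true]))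
    (.ite PolyTime.id.snd.snd.snd.fst (.const [true]) (.const []))

theorem polyTime_budgetBits :
    PolyTime (fun _ => 0) fun x : List RawClause × Bool => budgetBits x.1 x.2 :=
  PolyTime.ite PolyTime.id.snd (.append (.map (g := fun _ _ => true)
    (polyTime_distinctNames.comp PolyTime.id.fst) (.const true)) (.const [false, true]))
    (.const [true])

theorem polyTime_groupItems :
    PolyTime (fun x : List RawClause × List Bool × List CostRule => numAssocs x.2.1 x.1)
      fun x => groupItems x.1 x.2 := by
  refine PolyTime.map (g := fun (x : List RawClause × List Bool × List CostRule) a =>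
    ([true], x.2.2.map fun t => costBits x.1 a t))
    (polyTime_groupAssocs.comp' (PolyTime.id.snd.fst.pair PolyTime.id.fst)
      PolyTime.polyBdd_allowance) ?_
  refine PolyTime.of_le (e' := fun _ => 0) (.pair (.const [true]) ?_) (.const 0)
  exact PolyTime.map (g := fun (y : (List RawClause × List Bool × List CostRule) × Assoc) t =>
    costBits y.1.1 y.2 t) PolyTime.id.fst.snd.snd
    (polyTime_costBits.comp (PolyTime.id.fst.fst.fst.pair
      (PolyTime.id.fst.snd.pair PolyTime.id.snd)))

theorem polyTime_knapsackData :
    PolyTime (fun x : Layout × Name × List RawClause =>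
      (x.1.1.map fun w => numAssocs w.1 x.2.2).sum) fun x => knapsackData x.1 x.2.2 := by
  have hf : PolyTime (fun y : (Layout × Name × List RawClause) × List Bool × List CostRule =>
      numAssocs y.2.1 y.1.2.2) fun y => (y.1.2.2, y.2) :=
    PolyTime.id.fst.snd.snd.pair PolyTime.id.snd
  have h1 : PolyTime (fun y : (Layout × Name × List RawClause) × List Bool × List CostRule =>
      numAssocs y.2.1 y.1.2.2) fun y => groupItems y.1.2.2 y.2 := by
    have := PolyTime.comp' polyTime_groupItems hf ?_
    · exact this
    · exact PolyTime.polyBdd_allowance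
  have h2 : PolyTime (fun _ => 0) fun x : Layout × Name × List RawClause =>
      x.1.2.map (budgetBits x.2.2) :=
    PolyTime.map (g := fun (x : Layout × Name × List RawClause) t => budgetBits x.2.2 t)
      PolyTime.id.fst.snd (polyTime_budgetBits.comp (PolyTime.id.fst.snd.snd.pair PolyTime.id.snd))
  refine PolyTime.pair ?_ (h2.of_le (.const 0))
  refine PolyTime.flatMap' (g := fun (x : Layout × Name × List RawClause) w =>
    groupItems x.2.2 w) PolyTime.id.fst.fst h1 PolyTime.polyBdd_allowance fun a w hw => ?_
  have hw' : numAssocs w.1 a.2.2 ∈ a.1.1.map fun w => numAssocs w.1 a.2.2 :=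
    List.mem_map.2 ⟨w, hw, rfl⟩
  exact List.le_sum_of_mem hw'

/-! ### Names, partial assignments and the selection of clauses -/

theorem mem_names {C : List RawClause} {u : Name} :
    u ∈ names C ↔ ∃ c ∈ C, ∃ b, (b, u) ∈ c := by
  simp [names]

theorem mem_dedupNames {l : List Name} {u : Name} : u ∈ dedupNames l ↔ u ∈ l := by
  induction l using List.reverseRecOn with
  | nil => rfl
  | append_singleton l x ih =>
    rw [dedupNames, List.foldl_append, ← dedupNames, List.foldl_cons, List.foldl_nil,
      List.mem_append, List.mem_singleton, ← ih]
    split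
    · rename_i h
      simp only [List.contains_iff_mem] at h
      constructor
      · exact Or.inl
      · rintro (h' | rfl)
        · exact h'
        · exact h
    · rw [List.mem_cons, or_comm]

theorem nodup_dedupNames (l : List Name) : (dedupNames l).Nodup := by
  induction l using List.reverseRecOn with
  | nil => exact List.nodup_nil
  | append_singleton l x ih =>
    rw [dedupNames, List.foldl_append, ← dedupNames, List.foldl_cons, List.foldl_nil]
    split
    · exact ih
    · rename_i h
      exact List.nodup_cons.2 ⟨by simpa using h, ih⟩

theorem mem_distinctNames {C : List RawClause} {u : Name} : u ∈ distinctNames C ↔ u ∈ names C :=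
  mem_dedupNames

/-- The assignment `g`, restricted to the names of a list, as an association list. -/
def assocOf (U : List Name) (g : Name → Bool) : Assoc := U.reverse.map fun u => (u, g u)

theorem mem_partialAssocs {U N : List Name} (hU : U.Nodup) {a : Assoc} :
    a ∈ partialAssocs U N ↔ ∃ g : Name → Bool, (∀ u, g u = true → u ∈ N) ∧ a = assocOf U g := by
  induction U using List.reverseRecOn generalizing a with
  | nil =>
    simp only [partialAssocs, List.foldl_nil, List.mem_singleton, assocOf, List.reverse_nil,
      List.map_nil]
    exact ⟨fun h => ⟨fun _ => false, by simp, h⟩, fun ⟨_, _, h⟩ => h⟩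
  | append_singleton U u ih =>
    have hU' : U.Nodup := (List.nodup_append.1 hU).1
    have hu : u ∉ U := fun h => (List.nodup_append.1 hU).2.2 u h u (by simp) rfl
    have hcons (g : Name → Bool) : assocOf (U ++ [u]) g = (u, g u) :: assocOf U g := by
      simp [assocOf]
    rw [partialAssocs, List.foldl_append, ← partialAssocs, List.foldl_cons, List.foldl_nil,
      List.mem_flatMap]
    constructor
    · rintro ⟨a', ha', ha⟩
      obtain ⟨g, hg, rfl⟩ := (ih hU').1 ha'
      have key (b : Bool) (hb : b = true → u ∈ N) : ∃ g' : Name → Bool,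
          (∀ v, g' v = true → v ∈ N) ∧ (u, b) :: assocOf U g = assocOf (U ++ [u]) g' := by
        refine ⟨Function.update g u b, fun v hv => ?_, ?_⟩
        · by_cases h : v = u
          · subst h
            exact hb (by simpa using hv)
          · exact hg v (by simpa [h] using hv)
        · rw [hcons, Function.update_self]
          congr 1
          refine List.map_congr_left fun v hv => ?_
          have : v ≠ u := fun h => hu (by simpa [h] using hv)
          simp [this]
      split at ha
      · rename_i h
        rw [List.contains_iff_mem] at h
        simp only [List.mem_cons, List.not_mem_nil, or_false] at ha
        rcases ha with rfl | rfl
        · exact key false fun _ => h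
        · exact key true fun _ => h
      · simp only [List.mem_cons, List.not_mem_nil, or_false] at ha
        subst ha
        exact key false (by simp)
    · rintro ⟨g, hg, rfl⟩
      refine ⟨assocOf U g, (ih hU').2 ⟨g, hg, rfl⟩, ?_⟩
      rw [hcons]
      cases h : g u
      · split <;> simp
      · rw [if_pos (by simpa using hg u h)]
        simp

theorem satisfies_assocOf {U : List Name} {g : Name → Bool} {c : RawClause} :
    satisfies (assocOf U g) c = true ↔ ∃ l ∈ c, l.2 ∈ U ∧ g l.2 = l.1 := by
  simp only [satisfies, assocOf, List.any_eq_true, List.mem_map, List.mem_reverse]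
  constructor
  · rintro ⟨l, hl, _, ⟨u, hu, rfl⟩, h⟩
    rw [Bool.and_eq_true, beq_iff_eq] at h
    refine ⟨l, hl, h.1 ▸ hu, ?_⟩
    have h2 := h.2
    rw [← h.1]
    revert h2
    cases g u <;> cases l.1 <;> simp
  · rintro ⟨l, hl, hu, h⟩
    exact ⟨l, hl, _, ⟨l.2, hu, rfl⟩, by simp [h]⟩

/-- Whether `select P` takes the clause at position `q`. -/
def selects (P : List Bool) (q : ℕ) : Bool :=
  decide (q < P.length) || P.getD (q % P.length) false

/-- The state of `select` after reading `C`: the unread part of the pattern lists the decisions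
ahead, up to the end of a period. -/
theorem foldl_selectStep {P : List Bool} (hP : 0 < P.length) (C : List RawClause) :
    ∃ r o, C.foldl (selectStep P) (P.map fun _ => true, []) = (r, o) ∧
      (∀ i (h : i < r.length), r[i] = selects P (C.length + i)) ∧
      P.length ∣ C.length + r.length ∧ P.length ≤ C.length + r.length ∧
      o.length = (List.range C.length).countP (selects P) ∧
      ∀ c, c ∈ o ↔ ∃ q, ∃ h : q < C.length, C[q] = c ∧ selects P q = true := by
  induction C using List.reverseRecOn with
  | nil =>
    refine ⟨_, _, rfl, fun i h => ?_, by simp, by simp, rfl, by simp⟩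
    have : i < P.length := by simpa using h
    simp [selects, this]
  | append_singleton C c ih =>
    obtain ⟨r, o, hro, hr, hdvd, hle, ho, hmem⟩ := ih
    obtain ⟨b, r', hr'⟩ : ∃ b r', (if r.isEmpty then P else r) = b :: r' := by
      apply List.exists_cons_of_ne_nil
      split
      · exact List.ne_nil_of_length_pos hP
      · rename_i h
        simpa using h
    have hcur : ∀ i (h : i < (b :: r').length), (b :: r')[i] = selects P (C.length + i) := by
      simp only [← hr']
      intro i h
      by_cases he : r = []
      · subst he
        simp only [List.length_nil, Nat.add_zero] at hdvd hle
        have hi : i < P.length := by simpa using h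
        have h1 : ¬ C.length + i < P.length := by omega
        have h2 : (C.length + i) % P.length = i := by
          rw [Nat.add_mod, Nat.mod_eq_zero_of_dvd hdvd, Nat.zero_add, Nat.mod_mod,
            Nat.mod_eq_of_lt hi]
        simp [selects, h1, h2, hi]
      · have he' : r.isEmpty = false := by simpa using he
        simp only [he', Bool.false_eq_true, if_false]
        exact hr i (by simpa [he'] using h)
    have hlen : P.length ∣ C.length + (b :: r').length ∧
        P.length ≤ C.length + (b :: r').length := by
      rw [← hr']
      split
      · rename_i he
        have he : r = [] := by simpa using he
        subst he
        simp only [List.length_nil, Nat.add_zero] at hdvd hle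
        exact ⟨hdvd.add (dvd_refl _), by omega⟩
      · exact ⟨hdvd, hle⟩
    have hb : b = selects P C.length := hcur 0 (by simp)
    refine ⟨r', if b then c :: o else o, ?_, fun i h => ?_, ?_, ?_, ?_, fun c' => ?_⟩
    · rw [List.foldl_append, hro, List.foldl_cons, List.foldl_nil]
      simp only [selectStep]
      rw [hr']
      rfl
    · have := hcur (i + 1) (by simpa using h)
      rw [List.length_append, List.length_singleton, add_assoc, add_comm 1 i, ← this]
      rfl
    · have := hlen.1
      rw [List.length_cons] at this
      rw [List.length_append, List.length_singleton, add_assoc, add_comm 1]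
      exact this
    · have := hlen.2
      rw [List.length_cons] at this
      rw [List.length_append, List.length_singleton]
      omega
    · rw [List.length_append, List.length_singleton, List.range_succ, List.countP_append, ← ho,
        List.countP_singleton, ← hb]
      cases b <;> simp
    · have hsplit : (∃ q, ∃ h : q < (C ++ [c]).length, (C ++ [c])[q] = c' ∧ selects P q = true) ↔
          (∃ q, ∃ h : q < C.length, C[q] = c' ∧ selects P q = true) ∨
            c = c' ∧ selects P C.length = true := by
        constructor
        · rintro ⟨q, h, hq, hs⟩
          by_cases hqC : q < C.length
          · exact Or.inl ⟨q, hqC, by rwa [List.getElem_append_left hqC] at hq, hs⟩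
          · have : q = C.length := by
              rw [List.length_append, List.length_singleton] at h
              omega
            subst this
            exact Or.inr ⟨by simpa using hq, hs⟩
        · rintro (⟨q, h, hq, hs⟩ | ⟨hq, hs⟩)
          · exact ⟨q, by rw [List.length_append]; omega, by rwa [List.getElem_append_left h], hs⟩
          · exact ⟨C.length, by simp, by simpa using hq, hs⟩
      rw [hsplit, ← hmem, ← hb]
      cases b <;> simp [or_comm, eq_comm]

theorem mem_select {P : List Bool} (hP : 0 < P.length) {C : List RawClause} {c : RawClause} :
    c ∈ select P C ↔ ∃ q, ∃ h : q < C.length, C[q] = c ∧ selects P q = true := by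
  obtain ⟨r, o, h, -, -, -, -, ho⟩ := foldl_selectStep hP C
  rw [select, h]
  exact ho c

theorem length_select {P : List Bool} (hP : 0 < P.length) (C : List RawClause) :
    (select P C).length = ((Finset.range C.length).filter fun q => selects P q = true).card := by
  obtain ⟨r, o, h, -, -, -, ho, -⟩ := foldl_selectStep hP C
  rw [select, h, ← List.toFinset_range, ← List.toFinset_filter, List.toFinset_card_of_nodup
    (List.nodup_range.filter _), ← List.countP_eq_length_filter]
  exact ho

/-! ### Numbers given by their bits -/

/-- The number with the given bits, least significant bit first. -/
def natOf (l : List Bool) : ℕ := l.foldr Nat.bit 0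

theorem natOf_cons (b : Bool) (l : List Bool) : natOf (b :: l) = 2 * natOf l + b.toNat := by
  rw [natOf, List.foldr_cons, Nat.bit_val]
  rfl

theorem natOf_bits (n : ℕ) : natOf n.bits = n := by
  induction n using Nat.binaryRec' with
  | zero => rfl
  | bit b n h ih => rw [Nat.bits_append_bit _ _ h, natOf_cons, ih, Nat.bit_val]

theorem bits_injective : Function.Injective Nat.bits :=
  Function.LeftInverse.injective natOf_bits

theorem natOf_append_true (l : List Bool) : natOf (l ++ [true]) = natOf l + 2 ^ l.length := by
  induction l with
  | nil => rfl
  | cons b l ih =>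
    rw [List.cons_append, natOf_cons, ih, natOf_cons, List.length_cons, pow_succ]
    ring

theorem bits_natOf (l : List Bool) : (natOf (l ++ [true])).bits = l ++ [true] := by
  induction l with
  | nil => simp [natOf]
  | cons b l ih =>
    rw [List.cons_append, natOf, List.foldr_cons, Nat.bits_append_bit, ← natOf, ih]
    intro h
    rw [← natOf, natOf_append_true] at h
    have := Nat.two_pow_pos l.length
    omega

theorem natOf_map_not (l : List Bool) : natOf (l.map not) + natOf l + 1 = 2 ^ l.length := by
  induction l with
  | nil => rfl
  | cons b l ih =>
    rw [List.map_cons, natOf_cons, natOf_cons, List.length_cons, pow_succ, ← ih]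
    cases b <;> simp <;> ring

theorem natOf_inj {l l' : List Bool} (h : l.length = l'.length) (hn : natOf l = natOf l') :
    l = l' := by
  induction l generalizing l' with
  | nil => exact (List.length_eq_zero_iff.1 h.symm).symm
  | cons b l ih =>
    cases l' with
    | nil => simp at h
    | cons b' l' =>
      rw [natOf_cons, natOf_cons] at hn
      have h1 : natOf l = natOf l' := by
        cases b <;> cases b' <;> simp at hn <;> omega
      rw [h1] at hn
      rw [ih (by simpa using h) h1]
      cases b <;> cases b' <;> simp_all

/-! ### The knapsack instance of a formula -/

section Reduction

variable {D k d : ℕ}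

/-- The clauses of a formula, in the form in which they are encoded. -/
def rawClauses (φ : ThreeSat D) : List RawClause :=
  φ.clauses.map fun c => List.ofFn fun j => ((c j).2, ((c j).1 : ℕ).bits)

theorem enc_bits (n : ℕ) : enc n.bits = Data.ofNat n := rfl

theorem enc_rawClauses (φ : ThreeSat D) : enc (φ.numVars.bits, rawClauses φ) = φ.encode := by
  rw [enc_pair, enc_bits, ThreeSat.encode]
  congr 1
  simp only [rawClauses, enc, List.map_map]
  congr 1

/-- How an item of group `j` is charged in the dimension that belongs to the pair `p` of groups. In
the dimension `(i, i)` the items of group `i` cost `1`; in the dimension `(i, i')` the values of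
an item of group `i` at the names of group `i'` are compared with those of an item of group
`i'` at the names of group `i`. -/
def costRule (P : Fin k → List Bool) (j : Fin k) (p : Fin k × Fin k) : CostRule :=
  if p.1 = p.2 then (false, decide (j = p.1), [])
  else if j = p.1 then (true, false, P p.2)
  else if j = p.2 then (true, true, P p.1)
  else (false, false, [])

/-- The part of the input of the reduction that does not depend on the formula. -/
def layout (P : Fin k → List Bool) (dim : Fin d → Fin k × Fin k) : Layout :=
  ((List.finRange k).map fun j => (P j, List.ofFn fun δ => costRule P j (dim δ)),
    List.ofFn fun δ => decide ((dim δ).1 ≠ (dim δ).2))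

/-- The items of the knapsack instance: groups with an assignment. -/
def groupedAssocs (P : Fin k → List Bool) (C : List RawClause) : List (Fin k × Assoc) :=
  (List.finRange k).flatMap fun j => (groupAssocs (P j) C).map (Prod.mk j)

/-- The knapsack instance for a list of clauses. -/
def knapsackInstance (P : Fin k → List Bool) (dim : Fin d → Fin k × Fin k)
    (C : List RawClause) : Instance d where
  numItems := (groupedAssocs P C).length
  profit _ := 1
  cost x δ := natOf (costBits C ((groupedAssocs P C).get x).2
    (costRule P ((groupedAssocs P C).get x).1 (dim δ)))
  budget δ := natOf (budgetBits C (decide ((dim δ).1 ≠ (dim δ).2)))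

theorem ofNat_natOf_costBits (C : List RawClause) (a : Assoc) (t : CostRule) :
    Data.ofNat (natOf (costBits C a t)) = enc (costBits C a t) := by
  rw [← enc_bits, costBits]
  split
  · rw [bits_natOf]
  · split
    · rw [show [true] = [] ++ [true] from rfl, bits_natOf]
    · simp [natOf]

theorem ofNat_natOf_budgetBits (C : List RawClause) (t : Bool) :
    Data.ofNat (natOf (budgetBits C t)) = enc (budgetBits C t) := by
  rw [← enc_bits, budgetBits]
  split
  · rw [show [false, true] = [false] ++ [true] from rfl, ← List.append_assoc, bits_natOf]
  · rw [show [true] = [] ++ [true] from rfl, bits_natOf]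

theorem encode_knapsackInstance (P : Fin k → List Bool) (dim : Fin d → Fin k × Fin k)
    (C : List RawClause) :
    (knapsackInstance P dim C).encode = enc (knapsackData (layout P dim) C) := by
  have hitems : (layout P dim).1.flatMap (groupItems C) = (groupedAssocs P C).map fun p =>
      ([true], List.ofFn fun δ => costBits C p.2 (costRule P p.1 (dim δ))) := by
    simp only [layout, groupedAssocs, List.flatMap_map, List.map_flatMap, List.map_map]
    refine List.flatMap_congr fun j _ => ?_
    simp only [groupItems, List.map_ofFn]
    rfl
  rw [knapsackData, enc_pair, hitems, Instance.encode]
  congr 1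
  · simp only [enc, List.map_map]
    congr 1
    conv_rhs => rw [← List.ofFn_get (groupedAssocs P C), List.map_ofFn]
    refine congrArg List.ofFn (funext fun x => ?_)
    simp only [knapsackInstance, Function.comp, ofNat_natOf_costBits]
    congr 1
    simp only [List.map_ofFn, enc]
    rfl
  · simp only [knapsackInstance, layout, ofNat_natOf_budgetBits, List.map_ofFn, enc]
    rfl

/-- The values of an assignment at the names of the clauses that `Q` selects. -/
def valuesAt (Q : List Bool) (C : List RawClause) (a : Assoc) : List Bool :=
  a.map fun ub => ub.2 && (names (select Q C)).contains ub.1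

theorem length_valuesAt (Q : List Bool) (C : List RawClause) (a : Assoc) :
    (valuesAt Q C a).length = a.length := by simp [valuesAt]

theorem cost_self (P : Fin k → List Bool) (C : List RawClause) (a : Assoc) (j i : Fin k) :
    natOf (costBits C a (costRule P j (i, i))) = if j = i then 1 else 0 := by
  by_cases h : j = i <;> simp [costBits, costRule, natOf, h]

theorem cost_left (P : Fin k → List Bool) (C : List RawClause) (a : Assoc) {i i' : Fin k}
    (h : i ≠ i') : natOf (costBits C a (costRule P i (i, i'))) =
      natOf (valuesAt (P i') C a) + 2 ^ a.length := by
  rw [← length_valuesAt (P i') C a, ← natOf_append_true]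
  simp [costBits, costRule, h, valuesAt]

theorem cost_right (P : Fin k → List Bool) (C : List RawClause) (a : Assoc) {i i' : Fin k}
    (h : i ≠ i') : natOf (costBits C a (costRule P i' (i, i'))) +
      natOf (valuesAt (P i) C a) + 1 = 2 ^ a.length + 2 ^ a.length := by
  have h1 : costBits C a (costRule P i' (i, i')) = (valuesAt (P i) C a).map not ++ [true] := by
    simp only [costBits, costRule, h, h.symm, if_false, if_true, valuesAt, List.map_map,
      Function.comp_def, Bool.true_xor]
  rw [h1, natOf_append_true, List.length_map, length_valuesAt]
  have := natOf_map_not (valuesAt (P i) C a)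
  rw [length_valuesAt] at this
  omega

theorem cost_other (P : Fin k → List Bool) (C : List RawClause) (a : Assoc) {i i' j : Fin k}
    (h : i ≠ i') (h1 : j ≠ i) (h2 : j ≠ i') :
    natOf (costBits C a (costRule P j (i, i'))) = 0 := by
  simp [costBits, costRule, h, h1, h2, natOf]

theorem budget_off (C : List RawClause) :
    natOf (budgetBits C true) + 1 =
      2 ^ (distinctNames C).length + 2 ^ ((distinctNames C).length + 1) := by
  rw [budgetBits, if_pos rfl, show [false, true] = [false] ++ [true] from rfl,
    ← List.append_assoc, natOf_append_true]
  have key : ∀ l : List Name, natOf (l.map (fun _ => true) ++ [false]) + 1 = 2 ^ l.length := by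
    intro l
    induction l with
    | nil => rfl
    | cons b l ih =>
      rw [List.map_cons, List.cons_append, natOf_cons, List.length_cons, pow_succ, ← ih]
      simp
      ring
  have := key (distinctNames C)
  rw [List.length_append, List.length_map, List.length_singleton]
  omega

theorem mem_groupAssocs {Q : List Bool} {C : List RawClause} {a : Assoc} :
    a ∈ groupAssocs Q C ↔ ∃ g : Name → Bool, (∀ u, g u = true → u ∈ names (select Q C)) ∧
      a = assocOf (distinctNames C) g ∧
      ∀ c ∈ select Q C, ∃ l ∈ c, l.2 ∈ distinctNames C ∧ g l.2 = l.1 := by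
  rw [groupAssocs, List.mem_filter, mem_partialAssocs (U := distinctNames C) (nodup_dedupNames _),
    List.all_eq_true]
  constructor
  · rintro ⟨⟨g, hg, rfl⟩, h⟩
    exact ⟨g, hg, rfl, fun c hc => satisfies_assocOf.1 (h c hc)⟩
  · rintro ⟨g, hg, rfl, h⟩
    exact ⟨⟨g, hg, rfl⟩, fun c hc => satisfies_assocOf.2 (h c hc)⟩

theorem length_assocOf (U : List Name) (g : Name → Bool) : (assocOf U g).length = U.length := by
  simp [assocOf]

theorem valuesAt_assocOf (Q : List Bool) (C : List RawClause) (U : List Name) (g : Name → Bool) :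
    valuesAt Q C (assocOf U g) =
      U.reverse.map fun u => g u && (names (select Q C)).contains u := by
  simp [valuesAt, assocOf]

section Instance

variable {P : Fin k → List Bool} {dim : Fin d → Fin k × Fin k} {C : List RawClause}

/-- The group of an item. -/
def groupOf (P : Fin k → List Bool) (C : List RawClause) (x : Fin (groupedAssocs P C).length) :
    Fin k := ((groupedAssocs P C).get x).1

theorem exists_assignment (x : Fin (groupedAssocs P C).length) :
    ∃ g : Name → Bool, (∀ u, g u = true → u ∈ names (select (P (groupOf P C x)) C)) ∧
      ((groupedAssocs P C).get x).2 = assocOf (distinctNames C) g ∧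
      ∀ c ∈ select (P (groupOf P C x)) C, ∃ l ∈ c, l.2 ∈ distinctNames C ∧ g l.2 = l.1 := by
  have h := List.get_mem (groupedAssocs P C) x
  rw [groupOf]
  revert h
  generalize (groupedAssocs P C).get x = p
  intro h
  simp only [groupedAssocs, List.mem_flatMap, List.mem_map] at h
  obtain ⟨j, -, a, ha, rfl⟩ := h
  exact mem_groupAssocs.1 ha

theorem Instance.add_cost_le {I : Instance d} {S : Finset (Fin I.numItems)} (hS : I.IsSolution S)
    {x y : Fin I.numItems} (hx : x ∈ S) (hy : y ∈ S) (hxy : x ≠ y) (δ : Fin d) :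
    I.cost x δ + I.cost y δ ≤ I.budget δ := by
  refine (Finset.sum_pair (f := fun z => I.cost z δ) hxy).symm.le.trans
    ((Finset.sum_le_sum_of_subset fun z hz => ?_).trans (hS δ))
  rcases Finset.mem_insert.1 hz with rfl | hz
  · exact hx
  · rw [Finset.mem_singleton.1 hz]
    exact hy

/-- A solution contains at most one item of each group. -/
theorem groupOf_injOn (hdim : Function.Surjective dim)
    {S : Finset (Fin (groupedAssocs P C).length)}
    (hS : (knapsackInstance P dim C).IsSolution S) : Set.InjOn (groupOf P C) S := by
  intro x hx y hy hxy
  by_contra hne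
  obtain ⟨δ, hδ⟩ := hdim (groupOf P C x, groupOf P C x)
  have h2 := Instance.add_cost_le hS hx hy hne δ
  have h3 : ∀ z, groupOf P C z = groupOf P C x → (knapsackInstance P dim C).cost z δ = 1 := by
    intro z hz
    change natOf (costBits C _ (costRule P (groupOf P C z) (dim δ))) = 1
    rw [hδ, cost_self, if_pos hz]
  have h4 : (knapsackInstance P dim C).budget δ = 1 := by
    simp [knapsackInstance, hδ, budgetBits, natOf]
  rw [h3 x rfl, h3 y hxy.symm] at h2
  omega

/-- The values of two items of a solution are ordered, at the names that their groups share. -/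
theorem valuesAt_le (hdim : Function.Surjective dim)
    {S : Finset (Fin (groupedAssocs P C).length)}
    (hS : (knapsackInstance P dim C).IsSolution S) {x y : Fin (groupedAssocs P C).length}
    (hx : x ∈ S) (hy : y ∈ S) (hxy : groupOf P C x ≠ groupOf P C y) :
    natOf (valuesAt (P (groupOf P C y)) C ((groupedAssocs P C).get x).2) ≤
      natOf (valuesAt (P (groupOf P C x)) C ((groupedAssocs P C).get y).2) := by
  have hne : x ≠ y := fun h => hxy (by rw [h])
  obtain ⟨δ, hδ⟩ := hdim (groupOf P C x, groupOf P C y)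
  have h2 := Instance.add_cost_le hS hx hy hne δ
  have hlen : ∀ z, ((groupedAssocs P C).get z).2.length = (distinctNames C).length := by
    intro z
    obtain ⟨g, -, h, -⟩ := exists_assignment (P := P) z
    rw [h, length_assocOf]
  have h3 := cost_left P C ((groupedAssocs P C).get x).2 hxy
  have h4 := cost_right P C ((groupedAssocs P C).get y).2 hxy
  have h3' : (knapsackInstance P dim C).cost x δ = natOf (costBits C ((groupedAssocs P C).get x).2
      (costRule P (groupOf P C x) (groupOf P C x, groupOf P C y))) := by
    rw [← hδ]
    rfl
  have h4' : (knapsackInstance P dim C).cost y δ = natOf (costBits C ((groupedAssocs P C).get y).2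
      (costRule P (groupOf P C y) (groupOf P C x, groupOf P C y))) := by
    rw [← hδ]
    rfl
  have h5 := budget_off C
  have h5' : (knapsackInstance P dim C).budget δ = natOf (budgetBits C true) := by
    simp [knapsackInstance, hδ, hxy]
  rw [hlen] at h3 h4
  rw [pow_succ] at h5
  omega

/-- The items of a solution have the same values at the names that their groups share. -/
theorem valuesAt_eq (hdim : Function.Surjective dim)
    {S : Finset (Fin (groupedAssocs P C).length)}
    (hS : (knapsackInstance P dim C).IsSolution S) {x y : Fin (groupedAssocs P C).length}
    (hx : x ∈ S) (hy : y ∈ S) (hxy : groupOf P C x ≠ groupOf P C y) :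
    valuesAt (P (groupOf P C y)) C ((groupedAssocs P C).get x).2 =
      valuesAt (P (groupOf P C x)) C ((groupedAssocs P C).get y).2 := by
  refine natOf_inj ?_ ((valuesAt_le hdim hS hx hy hxy).antisymm
    (valuesAt_le hdim hS hy hx hxy.symm))
  obtain ⟨g, -, h, -⟩ := exists_assignment (P := P) x
  obtain ⟨g', -, h', -⟩ := exists_assignment (P := P) y
  rw [length_valuesAt, length_valuesAt, h, h', length_assocOf, length_assocOf]

theorem totalProfit_knapsackInstance (S : Finset (Fin (knapsackInstance P dim C).numItems)) :
    (knapsackInstance P dim C).totalProfit S = S.card :=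
  (Finset.card_eq_sum_ones S).symm

end Instance

variable {P : Fin k → List Bool} {dim : Fin d → Fin k × Fin k} {φ : ThreeSat D}

theorem length_rawClauses (φ : ThreeSat D) : (rawClauses φ).length = φ.clauses.length := by
  simp [rawClauses]

theorem mem_getElem_rawClauses {q : ℕ} {h : q < (rawClauses φ).length} {l : Bool × Name} :
    l ∈ (rawClauses φ)[q] ↔ ∃ j, (((φ.clauses[q]'(length_rawClauses φ ▸ h)) j).2,
      (((φ.clauses[q]'(length_rawClauses φ ▸ h)) j).1 : ℕ).bits) = l := by
  simp only [rawClauses, List.getElem_map, List.mem_ofFn]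

/-- The items of a solution fit together to an assignment that satisfies the clauses of all their
groups. -/
theorem exists_satisfied_of_isSolution (hP : ∀ j, 0 < (P j).length)
    (hdim : Function.Surjective dim)
    {S : Finset (Fin (groupedAssocs P (rawClauses φ)).length)}
    (hS : (knapsackInstance P dim (rawClauses φ)).IsSolution S) :
    ∃ s : Fin φ.numVars → Bool, ∀ q (h : q < φ.clauses.length),
      (∃ x ∈ S, selects (P (groupOf P (rawClauses φ) x)) q = true) →
        (φ.clauses[q]).Satisfied s := by
  choose g hg ha hsat using fun x => exists_assignment (P := P) (C := rawClauses φ) x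
  -- A variable is true as soon as one of the items makes it true.
  refine ⟨fun v => decide (∃ y ∈ S, g y (v : ℕ).bits = true), fun q hq ⟨x, hx, hxq⟩ => ?_⟩
  have hq' : q < (rawClauses φ).length := by rwa [length_rawClauses]
  have hmem : (rawClauses φ)[q] ∈
      select (P (groupOf P (rawClauses φ) x)) (rawClauses φ) :=
    (mem_select (hP _)).2 ⟨q, hq', rfl, hxq⟩
  obtain ⟨l, hl, hlU, hgl⟩ := hsat x _ hmem
  have hlN : l.2 ∈ names (select (P (groupOf P (rawClauses φ) x)) (rawClauses φ)) :=
    mem_names.2 ⟨_, hmem, l.1, hl⟩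
  obtain ⟨j, rfl⟩ := mem_getElem_rawClauses.1 hl
  refine ⟨j, ?_⟩
  dsimp only at hgl hlN hlU
  rw [← hgl, Bool.eq_iff_iff, decide_eq_true_iff]
  refine ⟨?_, fun h => ⟨x, hx, h⟩⟩
  rintro ⟨y, hy, hgy⟩
  by_cases hxy : groupOf P (rawClauses φ) x = groupOf P (rawClauses φ) y
  · rwa [groupOf_injOn hdim hS hx hy hxy]
  · have h := valuesAt_eq hdim hS hx hy hxy
    rw [ha x, ha y, valuesAt_assocOf, valuesAt_assocOf, List.map_inj_left] at h
    have h := h _ (List.mem_reverse.2 hlU)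
    rw [hgy, List.contains_iff_mem.2 hlN, Bool.and_true, Bool.and_eq_true] at h
    exact h.1

/-- A satisfying assignment gives one item of each group, and these form a solution. -/
theorem le_opt_of_sat (hP : ∀ j, 0 < (P j).length) (hsat : φ.sat = φ.numClauses) :
    k ≤ (knapsackInstance P dim (rawClauses φ)).opt := by
  set C := rawClauses φ with hC
  obtain ⟨s, -, hs⟩ := Finset.exists_mem_eq_sup (Finset.univ : Finset (Fin φ.numVars → Bool))
    Finset.univ_nonempty φ.numSatisfied
  have hall : ∀ c ∈ φ.clauses, c.Satisfied s := by
    have : φ.numSatisfied s = φ.clauses.length := by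
      rw [← hs]
      exact hsat
    simpa using List.countP_eq_length.1 this
  let f : Name → Bool := fun u => decide (∃ v : Fin φ.numVars, (v : ℕ).bits = u ∧ s v = true)
  have hf (v : Fin φ.numVars) : f (v : ℕ).bits = s v := by
    rw [Bool.eq_iff_iff, decide_eq_true_iff]
    refine ⟨?_, fun h => ⟨v, rfl, h⟩⟩
    rintro ⟨w, hw, h⟩
    rwa [← Fin.ext (bits_injective hw)]
  let g : Fin k → Name → Bool := fun j u => f u && (names (select (P j) C)).contains u
  have hmem (j : Fin k) : (j, assocOf (distinctNames C) (g j)) ∈ groupedAssocs P C := by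
    refine List.mem_flatMap.2 ⟨j, List.mem_finRange j, List.mem_map.2 ⟨_, mem_groupAssocs.2
      ⟨g j, fun u hu => ?_, rfl, fun c hc => ?_⟩, rfl⟩⟩
    · rw [Bool.and_eq_true] at hu
      simpa using hu.2
    · obtain ⟨q, hq, rfl, hqs⟩ := (mem_select (hP j)).1 hc
      have hq' : q < φ.clauses.length := by rwa [← length_rawClauses]
      obtain ⟨i, hi⟩ := hall _ (List.getElem_mem hq')
      have hl := mem_getElem_rawClauses (h := hq).2 ⟨i, rfl⟩
      refine ⟨_, hl, ?_, ?_⟩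
      · exact mem_distinctNames.2 (mem_names.2 ⟨_, List.getElem_mem hq, _, hl⟩)
      · have : (names (select (P j) C)).contains (((φ.clauses[q]) i).1 : ℕ).bits = true :=
          List.contains_iff_mem.2 (mem_names.2 ⟨_, hc, _, hl⟩)
        simp only [g]
        rw [this, hf, hi, Bool.and_true]
  choose x hx using fun j => List.mem_iff_get.1 (hmem j)
  have hxinj : Function.Injective x := fun i j hij => by
    have := (hx i).symm.trans ((congrArg _ hij).trans (hx j))
    exact congrArg Prod.fst this
  obtain ⟨y, hyinj, hcost⟩ : ∃ y : Fin k → Fin (knapsackInstance P dim C).numItems,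
      Function.Injective y ∧ ∀ j δ, (knapsackInstance P dim C).cost (y j) δ =
        natOf (costBits C (assocOf (distinctNames C) (g j)) (costRule P j (dim δ))) := by
    refine ⟨x, hxinj, fun j δ => ?_⟩
    simp only [knapsackInstance]
    rw [hx]
  have hsol : (knapsackInstance P dim C).IsSolution (Finset.univ.image y) := by
    intro δ
    rw [Finset.sum_image hyinj.injOn]
    simp only [hcost]
    obtain ⟨i, i', hδ⟩ : ∃ i i', dim δ = (i, i') := ⟨_, _, rfl⟩
    rw [hδ]
    by_cases hi : i = i'
    · subst hi
      simp only [cost_self]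
      simp [knapsackInstance, hδ, budgetBits, natOf]
    · rw [Finset.sum_eq_add i i' hi (fun j _ hj => cost_other _ _ _ hi hj.1 hj.2) (by simp)
        (by simp)]
      have h1 := cost_left P C (assocOf (distinctNames C) (g i)) hi
      have h2 := cost_right P C (assocOf (distinctNames C) (g i')) hi
      have h3 := budget_off C
      have h4 : (knapsackInstance P dim C).budget δ = natOf (budgetBits C true) := by
        simp [knapsackInstance, hδ, hi]
      have h5 : valuesAt (P i') C (assocOf (distinctNames C) (g i)) =
          valuesAt (P i) C (assocOf (distinctNames C) (g i')) := by
        rw [valuesAt_assocOf, valuesAt_assocOf]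
        refine List.map_congr_left fun u _ => ?_
        simp only [g, Bool.and_assoc]
        rw [Bool.and_comm (List.contains _ _)]
      rw [length_assocOf] at h1 h2
      rw [h5] at h1
      rw [pow_succ] at h3
      omega
  have hle : (knapsackInstance P dim C).totalProfit (Finset.univ.image y) ≤
      (knapsackInstance P dim C).opt :=
    Finset.le_sup (f := (knapsackInstance P dim C).totalProfit)
      (Finset.mem_filter.2 ⟨Finset.mem_univ _, hsol⟩)
  rwa [totalProfit_knapsackInstance, Finset.card_image_of_injective _ hyinj, Finset.card_univ,
    Fintype.card_fin] at hle

end Reduction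

/-! ### Distributing the clauses over the groups -/

section Pattern

/-- The pattern of group `j`: the positions stand for the `r`-tuples of groups, and those of the
tuples in which `j` occurs are marked. -/
noncomputable def tuplePattern (r k : ℕ) (j : Fin k) : List Bool :=
  List.ofFn fun q : Fin (Fintype.card (Fin r → Fin k)) =>
    decide (∃ i, (Fintype.equivFin (Fin r → Fin k)).symm q i = j)

variable {r k : ℕ}

theorem card_tuples (r k : ℕ) : Fintype.card (Fin r → Fin k) = k ^ r := by simp

theorem length_tuplePattern (j : Fin k) : (tuplePattern r k j).length = k ^ r := by
  rw [tuplePattern, List.length_ofFn, card_tuples]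

theorem selects_tuplePattern (hk : 0 < k) (j : Fin k) (q : ℕ) :
    ∃ t : Fin r → Fin k, ((Fintype.equivFin (Fin r → Fin k) t : ℕ) = q % k ^ r) ∧
      (selects (tuplePattern r k j) q = true ↔ q < k ^ r ∨ ∃ i, t i = j) := by
  have hpos : 0 < k ^ r := Nat.pow_pos hk
  have hq : q % k ^ r < Fintype.card (Fin r → Fin k) := by
    rw [card_tuples]
    exact Nat.mod_lt _ hpos
  refine ⟨(Fintype.equivFin (Fin r → Fin k)).symm ⟨_, hq⟩, by simp, ?_⟩
  rw [selects, length_tuplePattern, Bool.or_eq_true, decide_eq_true_iff,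
    List.getD_eq_getElem _ _ (by rw [length_tuplePattern]; exact Nat.mod_lt _ hpos)]
  simp [tuplePattern]

/-- The number of positions after the first period that belong to given residues. -/
theorem card_filter_mod_mem_le (B : Finset ℕ) (L m : ℕ) (hL : 0 < L) :
    ((Finset.range m).filter fun q => L ≤ q ∧ q % L ∈ B).card ≤ B.card * (m / L) := by
  have h : (B ×ˢ Finset.Icc 1 (m / L)).card = B.card * (m / L) := by simp
  rw [← h]
  refine Finset.card_le_card_of_injOn (fun q => (q % L, q / L)) (fun q hq => ?_) ?_
  · simp only [Finset.coe_filter, Finset.mem_range, Set.mem_ofPred_eq] at hq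
    simp only [Finset.coe_product, Set.mem_prod, Finset.mem_coe, Finset.mem_Icc]
    exact ⟨hq.2.2, (Nat.one_le_div_iff hL).2 hq.2.1, Nat.div_le_div_right hq.1.le⟩
  · intro q _ q' _ h
    simp only [Prod.mk.injEq] at h
    rw [← Nat.div_add_mod q L, ← Nat.div_add_mod q' L, h.1, h.2]

/-- Only few clauses belong to none of the groups of a large set `T`: at most the fraction
`(1 - |T| / k) ^ r` of all tuples avoid `T`. -/
theorem card_missed_le (hk : 0 < k) (T : Finset (Fin k)) (m : ℕ) :
    ((Finset.range m).filter fun q => ∀ j ∈ T, ¬ selects (tuplePattern r k j) q = true).card *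
      k ^ r ≤ (k - T.card) ^ r * m := by
  rcases T.eq_empty_or_nonempty with hT | hT
  · subst hT
    rw [Finset.card_empty, Nat.sub_zero, mul_comm]
    exact Nat.mul_le_mul_left _ ((Finset.card_filter_le _ _).trans (Finset.card_range m).le)
  obtain ⟨j₀, hj₀⟩ := hT
  have hpos : 0 < k ^ r := Nat.pow_pos hk
  set B : Finset ℕ := (Fintype.piFinset fun _ : Fin r => Tᶜ).image
    fun t => (Fintype.equivFin (Fin r → Fin k) t : ℕ) with hB
  have hBcard : B.card ≤ (k - T.card) ^ r := by
    refine Finset.card_image_le.trans ?_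
    rw [Fintype.card_piFinset]
    simp [Finset.card_compl]
  have hsub : ((Finset.range m).filter fun q => ∀ j ∈ T, ¬ selects (tuplePattern r k j) q = true) ⊆
      (Finset.range m).filter fun q => k ^ r ≤ q ∧ q % k ^ r ∈ B := by
    intro q hq
    rw [Finset.mem_filter] at hq ⊢
    refine ⟨hq.1, ?_⟩
    obtain ⟨t, ht, h⟩ := selects_tuplePattern (r := r) hk j₀ q
    have h0 := hq.2 j₀ hj₀
    rw [h, not_or, not_lt] at h0
    refine ⟨h0.1, Finset.mem_image.2 ⟨t, Fintype.mem_piFinset.2 fun i => ?_, ht⟩⟩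
    rw [Finset.mem_compl]
    intro hi
    obtain ⟨t', ht', h'⟩ := selects_tuplePattern (r := r) hk (t i) q
    have : t' = t := (Fintype.equivFin (Fin r → Fin k)).injective (Fin.ext (ht'.trans ht.symm))
    exact hq.2 _ hi (h'.2 (Or.inr ⟨i, by rw [this]⟩))
  calc _ ≤ (B.card * (m / k ^ r)) * k ^ r := Nat.mul_le_mul_right _
        ((Finset.card_le_card hsub).trans (card_filter_mod_mem_le B _ m hpos))
    _ ≤ B.card * m := by rw [mul_assoc]; exact Nat.mul_le_mul_left _ (Nat.div_mul_le_self _ _)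
    _ ≤ _ := Nat.mul_le_mul_right _ hBcard

/-- Bernoulli's inequality, as a bound on the number of `r`-tuples that contain a given one of `k`
elements. -/
theorem pow_sub_pow_mul_le (hk : 0 < k) (r : ℕ) : (k ^ r - (k - 1) ^ r) * k ≤ r * k ^ r := by
  have h : k ^ r * k ≤ (k - 1) ^ r * k + r * k ^ r := by
    induction r with
    | zero => simp
    | succ r ih =>
      obtain ⟨l, rfl⟩ : ∃ l, k = l + 1 := ⟨k - 1, by omega⟩
      simp only [Nat.add_sub_cancel] at ih ⊢
      have h1 : l ^ r ≤ (l + 1) ^ r := Nat.pow_le_pow_left (by omega) _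
      rw [pow_succ, pow_succ]
      nlinarith
  rw [Nat.sub_mul]
  omega

/-- The number of clauses of a group. -/
theorem card_selected_le (hk : 0 < k) (j : Fin k) (m : ℕ) :
    k * ((Finset.range m).filter fun q => selects (tuplePattern r k j) q = true).card ≤
      k * k ^ r + r * m := by
  have hpos : 0 < k ^ r := Nat.pow_pos hk
  set A := Fintype.piFinset fun _ : Fin r => ({j}ᶜ : Finset (Fin k)) with hA
  set B : Finset ℕ := Aᶜ.image fun t => (Fintype.equivFin (Fin r → Fin k) t : ℕ) with hB
  have hBcard : B.card ≤ k ^ r - (k - 1) ^ r := by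
    refine Finset.card_image_le.trans ?_
    rw [Finset.card_compl, Fintype.card_piFinset, card_tuples]
    simp [Finset.card_compl]
  have hsub : ((Finset.range m).filter fun q => selects (tuplePattern r k j) q = true) ⊆
      Finset.range (k ^ r) ∪ (Finset.range m).filter fun q => k ^ r ≤ q ∧ q % k ^ r ∈ B := by
    intro q hq
    rw [Finset.mem_filter] at hq
    rw [Finset.mem_union, Finset.mem_filter, Finset.mem_range]
    by_cases hlt : q < k ^ r
    · exact Or.inl hlt
    · refine Or.inr ⟨hq.1, not_lt.1 hlt, ?_⟩
      obtain ⟨t, ht, h⟩ := selects_tuplePattern (r := r) hk j q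
      obtain ⟨i, hi⟩ := (h.1 hq.2).resolve_left hlt
      refine Finset.mem_image.2 ⟨t, Finset.mem_compl.2 fun htA => ?_, ht⟩
      have := Fintype.mem_piFinset.1 htA i
      simp [hi] at this
  have h1 := (Finset.card_le_card hsub).trans (Finset.card_union_le _ _)
  rw [Finset.card_range] at h1
  have h2 := card_filter_mod_mem_le B _ m hpos
  have h3 : k * (B.card * (m / k ^ r)) ≤ r * m := by
    calc k * (B.card * (m / k ^ r)) ≤ k * ((k ^ r - (k - 1) ^ r) * (m / k ^ r)) := by gcongr
      _ = ((k ^ r - (k - 1) ^ r) * k) * (m / k ^ r) := by ring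
      _ ≤ (r * k ^ r) * (m / k ^ r) := Nat.mul_le_mul_right _ (pow_sub_pow_mul_le hk r)
      _ = r * (k ^ r * (m / k ^ r)) := by ring
      _ ≤ r * m := Nat.mul_le_mul_left _ (Nat.mul_div_le _ _)
  calc _ ≤ k * (k ^ r + B.card * (m / k ^ r)) := Nat.mul_le_mul_left _ (h1.trans (by omega))
    _ ≤ _ := by rw [mul_add]; omega

end Pattern

/-! ### The size of the instance -/

variable {D : ℕ}

theorem length_of_mem_rawClauses {φ : ThreeSat D} {c : RawClause} (h : c ∈ rawClauses φ) :
    c.length = 3 := by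
  obtain ⟨c, -, rfl⟩ := List.mem_map.1 h
  simp

theorem mem_of_mem_select {Q : List Bool} (hQ : 0 < Q.length) {C : List RawClause} {c : RawClause}
    (h : c ∈ select Q C) : c ∈ C := by
  obtain ⟨q, hq, rfl, -⟩ := (mem_select hQ).1 h
  exact List.getElem_mem hq

theorem numAssocs_le {Q : List Bool} (hQ : 0 < Q.length) (φ : ThreeSat D) :
    numAssocs Q (rawClauses φ) ≤ 2 ^ (3 * (select Q (rawClauses φ)).length) := by
  refine Nat.pow_le_pow_right (by norm_num) ?_
  have h1 : (names (select Q (rawClauses φ))).length = 3 * (select Q (rawClauses φ)).length := by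
    have : ∀ l : List RawClause, (∀ c ∈ l, c.length = 3) → (names l).length = 3 * l.length := by
      intro l
      induction l with
      | nil => intro _; rfl
      | cons c l ih =>
        intro h
        have h2 := ih fun c hc => h c (by simp [hc])
        have h3 := h c (by simp)
        simp only [names, List.flatMap_cons, List.length_append, List.length_map,
          List.length_cons] at h2 ⊢
        omega
    exact this _ fun c hc => length_of_mem_rawClauses (mem_of_mem_select hQ hc)
  rw [← h1, List.countP_eq_length_filter]
  refine (List.Nodup.subperm ((nodup_dedupNames _).filter _) fun u hu => ?_).length_le
  simpa using (List.mem_filter.1 hu).2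

theorem numClauses_le (φ : ThreeSat D) : φ.clauses.length ≤ D * φ.numVars := by
  have key : ∀ l : List (Clause φ.numVars),
      l.length ≤ ∑ v, l.countP fun c => decide (c.Mentions v) := by
    intro l
    induction l with
    | nil => simp
    | cons c l ih =>
      simp only [List.countP_cons, Finset.sum_add_distrib, List.length_cons]
      refine Nat.add_le_add ih ?_
      have h : (if decide (c.Mentions (c 0).1) = true then 1 else 0) ≤
          ∑ v, if decide (c.Mentions v) = true then 1 else 0 :=
        Finset.single_le_sum (f := fun v => if decide (c.Mentions v) = true then 1 else 0)
          (fun _ _ => Nat.zero_le _) (Finset.mem_univ _)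
      rwa [if_pos (decide_eq_true ⟨0, rfl⟩)] at h
  calc _ ≤ _ := key φ.clauses
    _ ≤ ∑ _v : Fin φ.numVars, D := Finset.sum_le_sum fun v _ => φ.degree_le v
    _ = _ := by simp [mul_comm]

theorem esize_bits_le (n : ℕ) : esize n.bits ≤ 1 + n * 4 := by
  refine (esize_le_of_forall (c := 3) fun b _ => esize_bool_le b).trans ?_
  have : n.bits.length ≤ n := by
    rw [Nat.size_eq_bits_len, Nat.size_le]
    exact Nat.lt_two_pow_self
  omega

theorem esize_formula_le (φ : ThreeSat D) :
    esize (φ.numVars.bits, rawClauses φ) ≤ 23 * (D + 1) * (φ.numVars + 1) ^ 2 := by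
  have h1 := esize_bits_le φ.numVars
  have h2 : ∀ c ∈ rawClauses φ, esize c ≤ 19 + 12 * φ.numVars := by
    intro c hc
    refine (esize_le_of_forall (c := 5 + 4 * φ.numVars) fun l hl => ?_).trans ?_
    · obtain ⟨c, -, rfl⟩ := List.mem_map.1 hc
      obtain ⟨j, rfl⟩ := List.mem_ofFn.1 hl
      rw [esize_pair]
      have h3 := esize_bool_le (c j).2
      have h4 := esize_bits_le (c j).1
      have h5 := (c j).1.isLt
      omega
    · rw [length_of_mem_rawClauses hc]
      omega
  have h3 := esize_le_of_forall h2
  have h4 := numClauses_le φ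
  rw [length_rawClauses] at h3
  rw [esize_pair]
  have h5 : φ.clauses.length * (1 + (19 + 12 * φ.numVars)) ≤
      D * φ.numVars * (1 + (19 + 12 * φ.numVars)) := Nat.mul_le_mul_right _ h4
  have h6 : φ.numVars * (1 + (19 + 12 * φ.numVars)) ≤ 20 * (φ.numVars + 1) ^ 2 := by nlinarith
  have h7 := Nat.mul_le_mul_left D h6
  nlinarith

/-! ### Calling an arbitrary program -/

section Call

variable {α β γ δ : Type} [Enc α] [Enc β] [Enc γ] [Enc δ]

/-- A program with a constant as part of its input. -/
theorem Computes.exists_const {p : Prog} {f : β × α → γ} {T : β × α → ℕ} (h : Computes p f T)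
    (b : β) : ∃ (q : Prog) (T₀ : ℕ), Computes q (fun a => f (b, a)) fun a => T₀ + T (b, a) := by
  obtain ⟨r, T₀, hr⟩ := PolyTime.exists_prog_const (enc b)
  refine ⟨.seq (r.shift 1) (.seq (.setCons 0 1 0) p), T₀ + 1, fun a s hs => ?_⟩
  change Steps _ _ (T₀ + 1 + T (b, a)) _
  rw [add_assoc]
  refine Steps.seq ((hr _).shift fun s' h1 h2 => Steps.seq (Steps.setCons (h _ _ ?_)))
  have := h2 0 (by omega)
  simp_all [enc_pair]

/-- Any program `p` can be run between two others, in a part of the memory that the first of them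
has not touched: `p` may rely on all variables but its input being `nil`. -/
theorem exists_prog_outputs {p₁ p₂ : Prog} {f : α → β} {g : γ → δ} {T₁ : α → ℕ} {T₂ : γ → ℕ}
    (h₁ : Computes p₁ f T₁) (h₂ : Computes p₂ g T₂) (p : Prog) :
    ∃ q : Prog, ∀ a b t, p.Outputs (enc (f a)) t (enc b) →
      ∃ t', q.Outputs (enc a) t' (enc (g b)) ∧ t' ≤ T₁ a + (1 + (t + (1 + T₂ b))) := by
  set c := p₁.bound + 1 with hc
  refine ⟨.seq p₁ (.seq (.copy c 0) (.seq (p.shift c) (.seq (.copy 0 c) p₂))), ?_⟩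
  rintro a b t ⟨s, he, hs⟩
  obtain ⟨t₁, s₁, he₁, ht₁, hs₁⟩ := h₁ a (Function.update (fun _ => Data.nil) 0 (enc a)) (by simp)
  have hnil : ∀ i, c ≤ i → s₁ i = Data.nil := by
    intro i hi
    rw [he₁.eq_of_bound_le i (by omega), Function.update_of_ne (by omega)]
  have hstart : (fun i => Function.update s₁ c (s₁ 0) (c + i)) =
      Function.update (fun _ => Data.nil) 0 (enc (f a)) := by
    funext i
    by_cases hi : i = 0
    · subst hi
      simp [hs₁]
    · rw [Function.update_of_ne (by omega), Function.update_of_ne hi, hnil _ (by omega)]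
  have : Steps (.seq p₁ (.seq (.copy c 0) (.seq (p.shift c) (.seq (.copy 0 c) p₂))))
      (Function.update (fun _ => Data.nil) 0 (enc a)) (T₁ a + (1 + (t + (1 + T₂ b))))
      fun s' => s' 0 = enc (g b) := by
    refine Steps.seq ⟨t₁, s₁, he₁, ht₁, Steps.seq (Steps.copy (Steps.seq (Steps.shift
      (R := fun s' => s' 0 = enc b) ?_ fun s' h1 h2 => Steps.seq (Steps.copy (h₂ b _ ?_)))))⟩
    · rw [hstart]
      exact ⟨t, s, he, le_rfl, hs⟩
    · simpa using h1
  obtain ⟨t', s', he', ht', hs'⟩ := this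
  exact ⟨t', ⟨s', he', hs'⟩, ht'⟩

end Call

/-! ### Counting the chosen items -/

/-- Whether the list `x.2` has at least as many entries `true` as `x.1` has entries. -/
def countsUpTo (x : List Bool × List Bool) : Bool :=
  (x.2.foldl (fun b y => if y then b.tail else b) x.1).isEmpty

theorem polyTime_countsUpTo : PolyTime (fun _ => 0) countsUpTo := by
  refine PolyTime.isEmpty (PolyTime.foldl_of_growth (h := fun _ => 0) (e' := fun _ => 0)
    (g := fun (_ : List Bool × List Bool) (b : List Bool) (y : Bool) => if y then b.tail else b)
    PolyTime.id.snd PolyTime.id.fst (PolyTime.ite PolyTime.id.snd.snd PolyTime.id.snd.fst.tail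
    PolyTime.id.snd.fst) (.const 0) (fun a b y _ => ?_) fun _ _ _ _ => le_rfl)
  cases y
  · simp
  · cases b
    · simp
    · simp only [if_true, List.tail_cons, esize_cons]
      omega

theorem countsUpTo_iff (K l : List Bool) : countsUpTo (K, l) = true ↔ K.length ≤ l.count true := by
  rw [countsUpTo]
  induction l generalizing K with
  | nil => cases K <;> simp
  | cons y l ih =>
    rw [List.foldl_cons, ih, List.count_cons]
    cases y <;> simp

theorem count_true_ofFn {n : ℕ} (S : Finset (Fin n)) :
    (List.ofFn fun i => decide (i ∈ S)).count true = S.card := by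
  rw [List.ofFn_eq_map, List.count, List.countP_map, List.countP_eq_length_filter,
    ← List.toFinset_card_of_nodup ((List.nodup_finRange n).filter _)]
  congr 1
  ext i
  simp

theorem encodeSet_eq {d : ℕ} (I : Instance d) (S : Finset (Fin I.numItems)) :
    I.encodeSet S = enc (List.ofFn fun i => decide (i ∈ S)) := by
  rw [Instance.encodeSet]
  simp only [enc, List.map_ofFn]
  rfl

/-! ### The gap -/

/-- All entries of a list outside the positions `B` satisfy `p`, so that at most `|B|` fail. -/
theorem length_le_countP_add_card {β : Type} (p : β → Bool) (l : List β) (B : Finset ℕ)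
    (h : ∀ q (hq : q < l.length), q ∉ B → p l[q] = true) : l.length ≤ l.countP p + B.card := by
  induction l using List.reverseRecOn generalizing B with
  | nil => simp
  | append_singleton l x ih =>
    have h1 := ih (B.erase l.length) fun q hq hqB => by
      have := h q (by rw [List.length_append]; omega) fun hB =>
        hqB (Finset.mem_erase.2 ⟨by omega, hB⟩)
      rwa [List.getElem_append_left hq] at this
    rw [List.length_append, List.length_singleton, List.countP_append, List.countP_singleton]
    by_cases hB : l.length ∈ B
    · have := Finset.card_erase_add_one hB
      omega
    · have h2 := h l.length (by simp) hB
      rw [List.getElem_append_right le_rfl] at h2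
      have h3 : p x = true := by simpa using h2
      rw [Finset.erase_eq_of_notMem hB] at h1
      rw [if_pos h3]
      omega

variable {D d k r : ℕ}

/-- If the knapsack instance has a solution with many items, then some assignment satisfies almost
all clauses. -/
theorem le_sat_of_isSolution (hk : 0 < k) {dim : Fin d → Fin k × Fin k}
    (hdim : Function.Surjective dim) {ρ ε : ℝ} (hr : (1 - ρ) ^ r ≤ ε)
    (φ : ThreeSat D)
    {S : Finset (Fin (groupedAssocs (tuplePattern r k) (rawClauses φ)).length)}
    (hS : (knapsackInstance (tuplePattern r k) dim (rawClauses φ)).IsSolution S)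
    (hcard : ρ * k ≤ S.card) : (1 - ε) * (φ.numClauses : ℝ) ≤ φ.sat := by
  have hP : ∀ j, 0 < (tuplePattern r k j).length := fun j => by
    rw [length_tuplePattern]
    exact Nat.pow_pos hk
  obtain ⟨s, hs⟩ := exists_satisfied_of_isSolution hP hdim hS
  set T := S.image (groupOf (tuplePattern r k) (rawClauses φ)) with hT
  have hTcard : T.card = S.card := Finset.card_image_of_injOn (groupOf_injOn hdim hS)
  have hTk : T.card ≤ k := by simpa using Finset.card_le_univ T
  set B := (Finset.range φ.clauses.length).filter
    fun q => ∀ j ∈ T, ¬ selects (tuplePattern r k j) q = true with hB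
  have h1 : φ.clauses.length ≤ φ.numSatisfied s + B.card := by
    refine length_le_countP_add_card _ _ _ fun q hq hqB => decide_eq_true (hs q hq ?_)
    by_contra hno
    refine hqB (Finset.mem_filter.2 ⟨Finset.mem_range.2 hq, fun j hj hjq => hno ?_⟩)
    obtain ⟨x, hx, rfl⟩ := Finset.mem_image.1 hj
    exact ⟨x, hx, hjq⟩
  have h2 : φ.numSatisfied s ≤ φ.sat := Finset.le_sup (Finset.mem_univ s)
  have h3 : B.card * k ^ r ≤ (k - T.card) ^ r * φ.clauses.length := card_missed_le hk T _
  have hk0 : (0 : ℝ) < k := by exact_mod_cast hk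
  have h4 : (B.card : ℝ) * (k : ℝ) ^ r ≤ ε * φ.clauses.length * (k : ℝ) ^ r := by
    have h5 : (B.card : ℝ) * (k : ℝ) ^ r ≤ ((k : ℝ) - T.card) ^ r * φ.clauses.length := by
      rw [← Nat.cast_sub hTk]
      exact_mod_cast h3
    have h6 : (k : ℝ) - T.card ≤ (1 - ρ) * k := by
      rw [hTcard]
      linarith
    have h7 : (0 : ℝ) ≤ (k : ℝ) - T.card := by
      rw [sub_nonneg]
      exact_mod_cast hTk
    calc _ ≤ _ := h5
      _ ≤ ((1 - ρ) * k) ^ r * φ.clauses.length := by gcongr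
      _ = (1 - ρ) ^ r * φ.clauses.length * (k : ℝ) ^ r := by rw [mul_pow]; ring
      _ ≤ _ := by gcongr
  have h8 : (B.card : ℝ) ≤ ε * φ.clauses.length := le_of_mul_le_mul_right h4 (by positivity)
  have h9 : (φ.clauses.length : ℝ) ≤ φ.sat + B.card := by exact_mod_cast (by omega)
  rw [ThreeSat.numClauses]
  linarith

/-! ### The running time of the whole algorithm -/

theorem le_two_mul_two_rpow (y : ℝ) : y ≤ 2 * (2 : ℝ) ^ y := by
  rcases le_total y 0 with hy | hy
  · exact hy.trans (by positivity)
  · have h := Real.add_one_le_exp (Real.log 2 * y)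
    rw [← Real.rpow_def_of_pos (by norm_num : (0 : ℝ) < 2)] at h
    have := Real.log_two_gt_d9
    nlinarith

/-- A polynomial factor is absorbed into an exponential one. -/
theorem sq_le_mul_two_rpow (hk : 0 < k) (n : ℕ) :
    ((n : ℝ) + 1) ^ 2 ≤ (4 * k + 1) ^ 2 * (2 : ℝ) ^ ((n : ℝ) / k) := by
  have hk0 : (0 : ℝ) < k := by exact_mod_cast hk
  set y : ℝ := n / (2 * k) with hy
  have h1 : (n : ℝ) = 2 * k * y := by rw [hy]; field_simp
  have h2 : (1 : ℝ) ≤ 2 ^ y := Real.one_le_rpow (by norm_num) (by positivity)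
  have h3 := le_two_mul_two_rpow y
  have h4 : (2 : ℝ) ^ ((n : ℝ) / k) = (2 ^ y) ^ 2 := by
    rw [← Real.rpow_natCast, ← Real.rpow_mul (by norm_num), hy]
    congr 1
    push_cast
    field_simp
  rw [h4, ← mul_pow]
  refine pow_le_pow_left₀ (by positivity) ?_ 2
  calc (n : ℝ) + 1 ≤ 2 * k * (2 * 2 ^ y) + 1 * 2 ^ y := by
        rw [h1]
        gcongr
        linarith
    _ = _ := by ring

/-- The quantity in which the running time of the reduction is polynomial. -/
theorem exists_measure_le (D r : ℕ) (hk : 0 < k) (dim : Fin d → Fin k × Fin k) :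
    ∃ A : ℝ, 1 ≤ A ∧ ∀ φ : ThreeSat D,
      ((esize (layout (tuplePattern r k) dim, φ.numVars.bits, rawClauses φ) +
        ((layout (tuplePattern r k) dim).1.map fun w => numAssocs w.1 (rawClauses φ)).sum +
        2 : ℕ) : ℝ) ≤ A * 2 ^ ((3 * r * D + 1) * φ.numVars / k : ℝ) := by
  set W := layout (tuplePattern r k) dim with hW
  refine ⟨3 + esize W + 23 * (D + 1) * (4 * k + 1) ^ 2 + k * 2 ^ (3 * k ^ r), ?_, fun φ => ?_⟩
  · have h1 : (0 : ℝ) ≤ esize W := Nat.cast_nonneg _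
    have h2 : (0 : ℝ) ≤ 23 * (D + 1) * (4 * k + 1) ^ 2 := by positivity
    have h3 : (0 : ℝ) ≤ k * 2 ^ (3 * k ^ r) := by positivity
    linarith
  have hk0 : (0 : ℝ) < k := by exact_mod_cast hk
  set X : ℝ := 2 ^ ((3 * r * D + 1) * φ.numVars / k : ℝ) with hX
  have hX1 : 1 ≤ X := Real.one_le_rpow (by norm_num) (by positivity)
  have hform : (esize (φ.numVars.bits, rawClauses φ) : ℝ) ≤
      23 * (D + 1) * (4 * k + 1) ^ 2 * X := by
    have h1 : (esize (φ.numVars.bits, rawClauses φ) : ℝ) ≤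
        23 * (D + 1) * ((φ.numVars : ℝ) + 1) ^ 2 := by exact_mod_cast esize_formula_le φ
    have h2 : (2 : ℝ) ^ ((φ.numVars : ℝ) / k) ≤ X := by
      refine Real.rpow_le_rpow_of_exponent_le (by norm_num) ?_
      gcongr
      have : (0 : ℝ) ≤ 3 * r * D * φ.numVars := by positivity
      linarith
    calc _ ≤ _ := h1
      _ ≤ 23 * (D + 1) * ((4 * k + 1) ^ 2 * (2 : ℝ) ^ ((φ.numVars : ℝ) / k)) := by
        gcongr
        exact sq_le_mul_two_rpow hk _
      _ ≤ 23 * (D + 1) * ((4 * k + 1) ^ 2 * X) := by gcongr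
      _ = _ := by ring
  have hgroup : ∀ j : Fin k, (numAssocs (tuplePattern r k j) (rawClauses φ) : ℝ) ≤
      2 ^ (3 * k ^ r) * X := by
    intro j
    have hP : 0 < (tuplePattern r k j).length := by
      rw [length_tuplePattern]
      exact Nat.pow_pos hk
    set len := (select (tuplePattern r k j) (rawClauses φ)).length with hlen
    have h1 : (numAssocs (tuplePattern r k j) (rawClauses φ) : ℝ) ≤ 2 ^ (3 * len) := by
      exact_mod_cast numAssocs_le hP φ
    have h2 : k * len ≤ k * k ^ r + r * (D * φ.numVars) := by
      rw [hlen, length_select hP, length_rawClauses]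
      exact (card_selected_le hk j _).trans
        (Nat.add_le_add_left (Nat.mul_le_mul_left _ (numClauses_le φ)) _)
    have h3 : (k : ℝ) * len ≤ k * (k : ℝ) ^ r + r * (D * φ.numVars) := by exact_mod_cast h2
    have h4 : (3 * len : ℝ) ≤ 3 * (k : ℝ) ^ r + (3 * r * D + 1) * φ.numVars / k := by
      rw [← sub_le_iff_le_add', le_div_iff₀ hk0]
      have : (0 : ℝ) ≤ φ.numVars := Nat.cast_nonneg _
      linarith
    calc _ ≤ (2 : ℝ) ^ (3 * len) := h1
      _ = (2 : ℝ) ^ (3 * len : ℝ) := by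
        rw [← Real.rpow_natCast]
        push_cast
        rfl
      _ ≤ (2 : ℝ) ^ (3 * (k : ℝ) ^ r + (3 * r * D + 1) * φ.numVars / k) :=
        Real.rpow_le_rpow_of_exponent_le (by norm_num) h4
      _ = _ := by
        rw [Real.rpow_add (by norm_num), hX, ← Real.rpow_natCast 2]
        push_cast
        rfl
  have hsum : ((W.1.map fun w => numAssocs w.1 (rawClauses φ)).sum : ℝ) ≤
      k * 2 ^ (3 * k ^ r) * X := by
    have h1 : (W.1.map fun w => numAssocs w.1 (rawClauses φ)).sum =
        ∑ j, numAssocs (tuplePattern r k j) (rawClauses φ) := by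
      rw [hW, layout, List.map_map, ← List.ofFn_eq_map, List.sum_ofFn]
      rfl
    rw [h1]
    push_cast
    calc _ ≤ ∑ _j : Fin k, 2 ^ (3 * k ^ r) * X := Finset.sum_le_sum fun j _ => hgroup j
      _ = _ := by simp [mul_assoc]
  rw [esize_pair]
  push_cast at hsum ⊢
  have hW0 : (esize W : ℝ) ≤ esize W * X := le_mul_of_one_le_right (Nat.cast_nonneg _) hX1
  linarith

/-- A polynomial in `A * 2 ^ y`, with constants that do not depend on the exponent `y`, is bounded
by `2 ^ z` if its degree is small enough. -/
theorem rpow_mul_two_rpow_le {A y z e : ℝ} (hA : 1 ≤ A) (he : y * e ≤ z) :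
    (A * (2 : ℝ) ^ y) ^ e ≤ A ^ e * 2 ^ z := by
  rw [Real.mul_rpow (by linarith) (by positivity), ← Real.rpow_mul (by norm_num)]
  gcongr
  norm_num

theorem Instance.numItems_lt_size {d : ℕ} (I : Instance d) : I.numItems < I.size := by
  have h : ∀ l : List Data, l.length < (Data.ofList l).size := by
    intro l
    induction l with
    | nil => simp [Data.ofList, Data.size]
    | cons x l ih =>
      rw [List.length_cons, Data.ofList, Data.size]
      omega
  have h1 := h (List.ofFn fun i => Data.cons (Data.ofNat (I.profit i))
    (Data.ofList (List.ofFn fun j => Data.ofNat (I.cost i j))))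
  rw [List.length_ofFn] at h1
  rw [Instance.size, Instance.encode, Data.size]
  omega

end VK

open VK

theorem theorem3 (hGap : VK.GapETH) (ρ : ℝ) (hρ0 : 0 < ρ) (hρ1 : ρ < 1) :
    ∃ δ : ℝ, 0 < δ ∧ ∃ d₀ : ℕ, ∀ d : ℕ, d₀ ≤ d →
      ¬ ∃ p : VK.Prog, VK.IsApproxAlgorithm d ρ p ∧
        p.RunsInTime (VK.Instance.encode (d := d))
          (fun I => (I.size : ℝ) ^ (δ * Real.sqrt (d : ℝ))) := by
  obtain ⟨D, δ, ε, hδ0, -, hε0, -, hno⟩ := hGap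
  obtain ⟨r, hr⟩ := exists_pow_lt_of_lt_one hε0 (show 1 - ρ < 1 by linarith)
  -- The degrees of the polynomial bounds do not depend on `d`.
  obtain ⟨R, TR, hR, ⟨C₁, hTR⟩, C₂, hsize⟩ := polyTime_knapsackData
  obtain ⟨Q, TQ, hQ, ⟨C₃, hTQ⟩, -⟩ := polyTime_countsUpTo
  set C : ℕ := C₁ + C₂ + 1 with hC
  set a : ℝ := 3 * r * D + 1 with ha
  have ha0 : 0 < a := by positivity
  have hC0 : (0 : ℝ) < C := by positivity
  refine ⟨δ / (2 * a * C), by positivity, (⌈a * (C * (1 + C₃)) / δ⌉₊ + 1) ^ 2, ?_⟩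
  rintro d hd ⟨p, happrox, Cp, htime⟩
  set k := Nat.sqrt d with hkdef
  have hkd : ⌈a * (C * (1 + C₃)) / δ⌉₊ + 1 ≤ k := Nat.le_sqrt'.2 hd
  have hk : 0 < k := by omega
  have hk0 : (0 : ℝ) < k := by exact_mod_cast hk
  have hak : a * (C * (1 + C₃)) ≤ δ * k := by
    have h1 := Nat.le_ceil (a * (C * (1 + C₃)) / δ)
    have h2 : (⌈a * (C * (1 + C₃)) / δ⌉₊ : ℝ) ≤ k := Nat.cast_le.2 (by omega)
    rw [mul_comm δ]
    exact (div_le_iff₀ hδ0).1 (h1.trans h2)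
  have hsqrt : Real.sqrt d ≤ 2 * k := by
    have h1 : Real.sqrt d ≤ (k : ℝ) + 1 := Real.sqrt_le_iff.2 ⟨by positivity, by
      exact_mod_cast (Nat.lt_succ_sqrt' d).le⟩
    have h2 : (1 : ℝ) ≤ k := by exact_mod_cast hk
    linarith
  -- Dimensions for all pairs of groups; superfluous ones repeat a pair.
  obtain ⟨dim, hdim⟩ : ∃ dim : Fin d → Fin k × Fin k, Function.Surjective dim := by
    have : Nonempty (Fin k × Fin k) := ⟨(⟨0, hk⟩, ⟨0, hk⟩)⟩
    obtain ⟨e⟩ := Function.Embedding.nonempty_of_card_le (α := Fin k × Fin k) (β := Fin d)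
      (by simpa using Nat.sqrt_le d)
    exact ⟨_, Function.invFun_surjective e.injective⟩
  set W := layout (tuplePattern r k) dim with hW
  have hP : ∀ j : Fin k, 0 < (tuplePattern r k j).length := fun j => by
    rw [length_tuplePattern]
    exact Nat.pow_pos hk
  set K : List Bool := List.replicate ⌈ρ * k⌉₊ true with hK
  obtain ⟨R', T₀, hR'⟩ := hR.exists_const W
  obtain ⟨Q', T₁, hQ'⟩ := hQ.exists_const K
  obtain ⟨q, hq⟩ := exists_prog_outputs hR' hQ' p
  obtain ⟨A, hA, hmeasure⟩ := exists_measure_le D r hk dim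
  -- The run of the algorithm on a formula.
  have hrun : ∀ φ : ThreeSat D, ∃ (t : ℕ) (S : Finset _) (t' : ℕ),
      (knapsackInstance (tuplePattern r k) dim (rawClauses φ)).IsApproximate ρ S ∧
      (t : ℝ) ≤ Cp * ((knapsackInstance (tuplePattern r k) dim (rawClauses φ)).size : ℝ) ^
        (δ / (2 * a * C) * Real.sqrt d) ∧
      q.Outputs φ.encode t' (Data.ofBool (countsUpTo (K, List.ofFn fun i => decide (i ∈ S)))) ∧
      t' ≤ T₀ + TR (W, φ.numVars.bits, rawClauses φ) +
        (1 + (t + (1 + (T₁ + TQ (K, List.ofFn fun i => decide (i ∈ S)))))) := by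
    intro φ
    obtain ⟨t, S, hout, hS⟩ := happrox (knapsackInstance (tuplePattern r k) dim (rawClauses φ))
    obtain ⟨t₂, y, hout₂, ht₂⟩ := htime (knapsackInstance (tuplePattern r k) dim (rawClauses φ))
    have htt : t = t₂ := by
      obtain ⟨s, he, -⟩ := hout
      obtain ⟨s', he', -⟩ := hout₂
      exact (he.unique he').1
    rw [encode_knapsackInstance, encodeSet_eq] at hout
    obtain ⟨t', h1, h2⟩ := hq (φ.numVars.bits, rawClauses φ) _ t hout
    rw [enc_rawClauses] at h1
    exact ⟨t, S, t', hS, htt ▸ ht₂, h1, h2⟩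
  choose t S t' happ ht hout ht' using hrun
  have hcount : ∀ φ, countsUpTo (K, List.ofFn fun i => decide (i ∈ S φ)) = true ↔
      ρ * k ≤ (S φ).card := by
    intro φ
    rw [countsUpTo_iff, count_true_ofFn, hK, List.length_replicate, Nat.ceil_le]
  refine hno ⟨q, fun φ => ⟨t' φ, _, hout φ, fun hsat => ?_, fun hlt => ?_⟩, ?_⟩
  · rw [hcount]
    have h1 : (k : ℝ) ≤ (knapsackInstance (tuplePattern r k) dim (rawClauses φ)).opt := by
      exact_mod_cast le_opt_of_sat hP hsat
    have h2 := (happ φ).2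
    rw [totalProfit_knapsackInstance] at h2
    exact (mul_le_mul_of_nonneg_left h1 hρ0.le).trans h2
  · by_contra hne
    rw [Bool.not_eq_false, hcount] at hne
    exact absurd hlt (not_lt.2 (le_sat_of_isSolution hk hdim hr.le φ (happ φ).1 hne))
  · refine ⟨T₀ + T₁ + 2 + A ^ (C : ℝ) + |Cp| * A ^ (C * (δ / (2 * a * C) * Real.sqrt d)) +
      (esize K + 8) ^ C₃ * A ^ ((C * C₃ : ℕ) : ℝ), fun φ => ⟨t' φ, _, hout φ, ?_⟩⟩
    set I := knapsackInstance (tuplePattern r k) dim (rawClauses φ) with hI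
    set Y : ℝ := A * 2 ^ (a * φ.numVars / k : ℝ) with hY
    set Z : ℝ := 2 ^ (δ * φ.numVars : ℝ) with hZ
    have hn0 : (0 : ℝ) ≤ φ.numVars := Nat.cast_nonneg _
    have hZ1 : 1 ≤ Z := Real.one_le_rpow (by norm_num) (by positivity)
    have hY1 : 1 ≤ Y := one_le_mul_of_one_le_of_one_le hA
      (Real.one_le_rpow (by norm_num) (by positivity))
    have hexp : ∀ e : ℝ, a * e ≤ δ * k → Y ^ e ≤ A ^ e * Z := by
      intro e he
      refine rpow_mul_two_rpow_le hA ?_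
      rw [div_mul_eq_mul_div, div_le_iff₀ hk0]
      calc a * φ.numVars * e = (a * e) * φ.numVars := by ring
        _ ≤ (δ * k) * φ.numVars := by gcongr
        _ = _ := by ring
    have hm := hmeasure φ
    have hpoly : ∀ c ≤ C, ∀ x : ℕ, x ≤ (esize (W, φ.numVars.bits, rawClauses φ) +
        (W.1.map fun w => numAssocs w.1 (rawClauses φ)).sum + 2) ^ c → (x : ℝ) ≤ Y ^ C := by
      intro c hc x hx
      calc (x : ℝ) ≤ ((esize (W, φ.numVars.bits, rawClauses φ) +
            (W.1.map fun w => numAssocs w.1 (rawClauses φ)).sum + 2 : ℕ) : ℝ) ^ c := by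
            exact_mod_cast hx
        _ ≤ Y ^ c := pow_le_pow_left₀ (Nat.cast_nonneg _) hm c
        _ ≤ Y ^ C := pow_le_pow_right₀ hY1 hc
    have hTR' : (TR (W, φ.numVars.bits, rawClauses φ) : ℝ) ≤ Y ^ C :=
      hpoly C₁ (by omega) _ (hTR (W, φ.numVars.bits, rawClauses φ))
    have hIsize : (I.size : ℝ) ≤ Y ^ C := by
      refine hpoly C₂ (by omega) _ ?_
      rw [hI, Instance.size, encode_knapsackInstance]
      exact hsize (W, φ.numVars.bits, rawClauses φ)
    have hIpos : (0 : ℝ) ≤ I.size := Nat.cast_nonneg _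
    have hC' : a * (C : ℝ) ≤ δ * k := by
      refine le_trans ?_ hak
      gcongr
      exact le_mul_of_one_le_right hC0.le (by linarith [Nat.cast_nonneg (α := ℝ) C₃])
    have hb1 : Y ^ C ≤ A ^ (C : ℝ) * Z := by
      rw [← Real.rpow_natCast Y C]
      exact hexp _ hC'
    have hb2 : (t φ : ℝ) ≤ |Cp| * (A ^ (C * (δ / (2 * a * C) * Real.sqrt d)) * Z) := by
      refine (ht φ).trans ?_
      have he0 : 0 ≤ δ / (2 * a * C) * Real.sqrt d := by positivity
      have h1 : (I.size : ℝ) ^ (δ / (2 * a * C) * Real.sqrt d) ≤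
          A ^ (C * (δ / (2 * a * C) * Real.sqrt d)) * Z := by
        refine (Real.rpow_le_rpow hIpos hIsize he0).trans ?_
        rw [← Real.rpow_natCast Y C, ← Real.rpow_mul (by linarith)]
        refine hexp _ ?_
        calc a * (C * (δ / (2 * a * C) * Real.sqrt d)) = δ * (Real.sqrt d / 2) := by
              field_simp
          _ ≤ δ * k := by
              gcongr
              linarith
      calc _ ≤ |Cp| * (I.size : ℝ) ^ (δ / (2 * a * C) * Real.sqrt d) := by
            gcongr
            exact le_abs_self _
        _ ≤ _ := by gcongr
    have hb3 : (TQ (K, List.ofFn fun i => decide (i ∈ S φ)) : ℝ) ≤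
        (esize K + 8) ^ C₃ * (A ^ ((C * C₃ : ℕ) : ℝ) * Z) := by
      have h1 := hTQ (K, List.ofFn fun i => decide (i ∈ S φ))
      have h2 : esize (List.ofFn fun i => decide (i ∈ S φ)) ≤ 1 + I.size * 4 := by
        refine (esize_le_of_forall (c := 3) fun b _ => esize_bool_le b).trans ?_
        have h3 : (List.ofFn fun i => decide (i ∈ S φ)).length < I.size := by
          rw [List.length_ofFn]
          exact I.numItems_lt_size
        omega
      have h5 : (esize (K, List.ofFn fun i => decide (i ∈ S φ)) : ℝ) + 0 + 2 ≤
          (esize K + 8) * Y ^ C := by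
        have h6 : (esize (List.ofFn fun i => decide (i ∈ S φ)) : ℝ) ≤ 1 + I.size * 4 := by
          exact_mod_cast h2
        have h7 : (1 : ℝ) ≤ Y ^ C := one_le_pow₀ hY1
        have h8 : (esize K : ℝ) ≤ esize K * Y ^ C :=
          le_mul_of_one_le_right (Nat.cast_nonneg _) h7
        rw [esize_pair]
        push_cast
        linarith
      calc (TQ (K, List.ofFn fun i => decide (i ∈ S φ)) : ℝ) ≤
            ((esize (K, List.ofFn fun i => decide (i ∈ S φ)) : ℝ) + 0 + 2) ^ C₃ := by
            exact_mod_cast h1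
        _ ≤ ((esize K + 8) * Y ^ C) ^ C₃ := pow_le_pow_left₀ (by positivity) h5 _
        _ = (esize K + 8) ^ C₃ * Y ^ ((C * C₃ : ℕ) : ℝ) := by
            rw [mul_pow, ← pow_mul, Real.rpow_natCast]
        _ ≤ _ := by
            gcongr
            refine hexp _ ?_
            refine le_trans ?_ hak
            push_cast
            gcongr
            linarith
    have hb4 : (t' φ : ℝ) ≤ T₀ + TR (W, φ.numVars.bits, rawClauses φ) +
        (1 + (t φ + (1 + (T₁ + TQ (K, List.ofFn fun i => decide (i ∈ S φ)))))) := by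
      exact_mod_cast ht' φ
    have hb5 : ((T₀ : ℝ) + T₁ + 2) ≤ (T₀ + T₁ + 2) * Z :=
      le_mul_of_one_le_right (by positivity) hZ1
    calc (t' φ : ℝ) ≤ _ := hb4
      _ ≤ (T₀ + T₁ + 2) * Z + A ^ (C : ℝ) * Z +
          |Cp| * (A ^ (C * (δ / (2 * a * C) * Real.sqrt d)) * Z) +
          (esize K + 8) ^ C₃ * (A ^ ((C * C₃ : ℕ) : ℝ) * Z) := by linarith
      _ = _ := by ring
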